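/- Let $\Omega$ be a countably infinite set, $\mathrm{Inj}(\Omega)$ the monoid of injective maps $\Omega\to\Omega$ under composition, with maps written on the right of their arguments, and $\mathrm{Sym}(\Omega)$ the group of permutations of $\Omega$. Let $\mathrm{Alt}(\Omega)$ be the group of even finitary permutations, i.e. permutations of finite support that are products of an even number of transpositions. Let $\mathrm{Inj}_{\mathrm{fin}}(\Omega)$ (resp. $\mathrm{Inj}_\infty(\Omega)$) be the set of $f\in\mathrm{Inj}(\Omega)$ with $1\le|\Omega\setminus(\Omega)f|<\aleph_0$ (resp. $|\Omega\setminus(\Omega)f|=\aleph_0$). A subset of $\mathrm{Inj}(\Omega)$ is normal if it is closed under conjugation $f\mapsto afa^{-1}$ by all $a\in\mathrm{Sym}(\Omega)$. For $B\subseteq\mathrm{Inj}(\Omega)$ put $B_{\mathbb N}=\{|\Omega\setminus(\Omega)f|:f\in B\}\cap\mathbb N$, where $\mathbb N=\{0,1,2,\dots\}$. For an additive submonoid $N\subseteq\mathbb N$ let $\mathrm{Gn}(N)$ be its unique minimal generating set as a monoid. A cycle under $f$ is a nonempty set $\Sigma\subseteq\Omega$ such that for all $\alpha\in\Omega$, $(\alpha)f\in\Sigma\iff\alpha\in\Sigma$,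 and such that no proper nonempty subset of $\Sigma$ has this property. An infinite cycle $\Sigma$ is forward if $\Sigma\setminus(\Omega)f\neq\emptyset$, and open otherwise. Let $(f)\mathrm C_n$ ($n\in\mathbb Z_+$), $(f)\mathrm C_{\mathrm{open}}$, $(f)\mathrm C_{\mathrm{fwd}}$ be the numbers of cycles under $f$ of cardinality $n$, of open cycles and of forward cycles. Write $f\approx_{\mathrm{fin}}g$ if $(f)\mathrm C_{\mathrm{open}}=(g)\mathrm C_{\mathrm{open}}$, $(f)\mathrm C_{\mathrm{fwd}}=(g)\mathrm C_{\mathrm{fwd}}$, $(f)\mathrm C_n\ne(g)\mathrm C_n$ for only finitely many $n$, and $(f)\mathrm C_n,(g)\mathrm C_n$ are both finite whenever they differ. Write $f\approx_{\mathrm{even}}g$ if $f\approx_{\mathrm{fin}}g$ and $\sum_{n\in\mathbb Z_+}((f)\mathrm C_n-(g)\mathrm C_n)$ is even, a term being $0$ when $(f)\mathrm C_n=(g)\mathrm C_n$, even if both are infinite. For either relation $\approx$, a set $A\subseteq\mathrm{Inj}(\Omega)$ is $\approx$-closed if for all $f,g\in\mathrm{Inj}(\Omega)$ with $f\approx g$,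 $f\in A\iff g\in A$. **Proposition.** Let $M\subseteq\mathrm{Inj}(\Omega)$ be a submonoid with $M\cap\mathrm{Sym}(\Omega)=\mathrm{Alt}(\Omega)$, and let $M_{\mathrm{fin}}=M\cap\mathrm{Inj}_{\mathrm{fin}}(\Omega)$. Then $M$ is normal if and only if either $M=\mathrm{Alt}(\Omega)\cup M_{\mathrm{fin}}$ or $M=\mathrm{Alt}(\Omega)\cup M_{\mathrm{fin}}\cup\mathrm{Inj}_\infty(\Omega)$, and $$M_{\mathrm{fin}}=B\cup\{f\in\mathrm{Inj}(\Omega):|\Omega\setminus(\Omega)f|\in N\setminus(\mathrm{Gn}(N)\cup\{0\})\}$$ for some additive submonoid $N\subseteq\mathbb N$ and some subset $B\subseteq\mathrm{Inj}_{\mathrm{fin}}(\Omega)$ such that 1. $B_{\mathbb N}=\mathrm{Gn}(N)$; 2. $\{f\in B:(f)\mathrm C_{\mathrm{open}}+(f)\mathrm C_{\mathrm{fwd}}\ge2\}$ and $\{f\in B:\exists n\in\mathbb Z_+\,((f)\mathrm C_n=\aleph_0)\}$ are $\approx_{\mathrm{fin}}$-closed; 3. $\{f\in B:(f)\mathrm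 C_{\mathrm{open}}+(f)\mathrm C_{\mathrm{fwd}}=1\text{ and }\forall n\in\mathbb Z_+\,((f)\mathrm C_n<\aleph_0)\}$ is $\approx_{\mathrm{even}}$-closed. -/

import Mathlib

namespace InjMonoid

/-- The injective endomaps of `Ω`. -/
abbrev Inj (Ω : Type*) := Ω ↪ Ω

/-- `Inj Ω` is a monoid under composition. Maps are written on the right of their arguments,
so `f * g` means first `f`, then `g`. -/
instance instMonoidInj (Ω : Type*) : Monoid (Inj Ω) where
  mul f g := f.trans g
  one := Function.Embedding.refl Ω
  mul_assoc _ _ _ := rfl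
  one_mul _ := rfl
  mul_one _ := rfl

section Basic

variable {Ω : Type*}

/-- A set of injective maps is normal if it is closed under conjugation by permutations. -/
def IsNormal (A : Set (Inj Ω)) : Prop :=
  ∀ f ∈ A, ∀ a : Equiv.Perm Ω, (a.toEmbedding : Inj Ω) * f * (a.symm.toEmbedding : Inj Ω) ∈ A

/-- The complement of the image of `f`. -/
def coimage (f : Inj Ω) : Set Ω := (Set.range f)ᶜ

/-- The permutations of `Ω`, as a subset of `Inj Ω`. -/
def SymInj (Ω : Type*) : Set (Inj Ω) :=
  {f | ∃ a : Equiv.Perm Ω, a.toEmbedding = f}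

/-- A permutation is finitary if its support is finite. -/
def IsFinitary (a : Equiv.Perm Ω) : Prop := {x | a x ≠ x}.Finite

/-- A permutation is even if it is a product of an even number of transpositions. -/
def IsEven [DecidableEq Ω] (a : Equiv.Perm Ω) : Prop :=
  ∃ l : List (Equiv.Perm Ω), (∀ t ∈ l, t.IsSwap) ∧ Even l.length ∧ l.prod = a

open Classical in
/-- The even finitary permutations of `Ω`, as a subset of `Inj Ω`. -/
def Alt (Ω : Type*) : Set (Inj Ω) :=
  {f | ∃ a : Equiv.Perm Ω, IsFinitary a ∧ IsEven a ∧ a.toEmbedding = f}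

/-- The injective maps whose coimage is finite and nonempty. -/
def InjFin (Ω : Type*) : Set (Inj Ω) :=
  {f | (coimage f).Nonempty ∧ (coimage f).Finite}

/-- The injective maps whose coimage is infinite. -/
def InjInf (Ω : Type*) : Set (Inj Ω) :=
  {f | (coimage f).Infinite}

/-- The set of natural numbers that occur as the size of the coimage of some member of `A`. -/
def coimageSizes (A : Set (Inj Ω)) : Set ℕ :=
  {n | ∃ f ∈ A, (coimage f).encard = n}

/-- `S` satisfies: `(x)f ∈ S` if and only if `x ∈ S`, for all `x`. -/
def IsFullyInvariant (f : Inj Ω) (S : Set Ω) : Prop := ∀ x, f x ∈ S ↔ x ∈ S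

/-- `S` is a cycle under `f`: a minimal nonempty set satisfying `IsFullyInvariant f`. -/
def IsCycle (f : Inj Ω) (S : Set Ω) : Prop :=
  S.Nonempty ∧ IsFullyInvariant f S ∧ ∀ T ⊂ S, T.Nonempty → ¬ IsFullyInvariant f T

/-- An infinite cycle that is not contained in the image of `f`. -/
def IsForwardCycle (f : Inj Ω) (S : Set Ω) : Prop :=
  IsCycle f S ∧ S.Infinite ∧ (S \ Set.range f).Nonempty

/-- An infinite cycle that is not a forward cycle. -/
def IsOpenCycle (f : Inj Ω) (S : Set Ω) : Prop :=
  IsCycle f S ∧ S.Infinite ∧ ¬ IsForwardCycle f S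

/-- The number of cycles under `f` of cardinality `n`. -/
noncomputable def numCycles (f : Inj Ω) (n : ℕ+) : ℕ∞ :=
  {S : Set Ω | IsCycle f S ∧ S.encard = (n : ℕ)}.encard

/-- The number of open cycles under `f`. -/
noncomputable def numOpen (f : Inj Ω) : ℕ∞ := {S : Set Ω | IsOpenCycle f S}.encard

/-- The number of forward cycles under `f`. -/
noncomputable def numFwd (f : Inj Ω) : ℕ∞ := {S : Set Ω | IsForwardCycle f S}.encard

/-- The relation `≈_fin`. -/
def FinEquiv (f g : Inj Ω) : Prop :=
  numOpen f = numOpen g ∧ numFwd f = numFwd g ∧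
  {n : ℕ+ | numCycles f n ≠ numCycles g n}.Finite ∧
  ∀ n : ℕ+, numCycles f n ≠ numCycles g n → numCycles f n < ⊤ ∧ numCycles g n < ⊤

/-- The relation `≈_even`. If `FinEquiv f g`, then only finitely many terms of the sum are nonzero,
and the terms with `numCycles f n = numCycles g n` are zero, also when both numbers are infinite. -/
def EvenEquiv (f g : Inj Ω) : Prop :=
  FinEquiv f g ∧
  Even (∑ᶠ n : ℕ+, (((numCycles f n).toNat : ℤ) - ((numCycles g n).toNat : ℤ)))

/-- `A` is `≈_fin`-closed. -/
def FinClosed (A : Set (Inj Ω)) : Prop := ∀ f g : Inj Ω, FinEquiv f g → (f ∈ A ↔ g ∈ A)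

/-- `A` is `≈_even`-closed. -/
def EvenClosed (A : Set (Inj Ω)) : Prop := ∀ f g : Inj Ω, EvenEquiv f g → (f ∈ A ↔ g ∈ A)

end Basic

/-- The intersection of all generating sets of an additive submonoid `N` of the natural numbers.
It is the least generating set of `N` (see `closure_Gn` and `Gn_subset`). -/
def Gn (N : AddSubmonoid ℕ) : Set ℕ := ⋂₀ {G : Set ℕ | AddSubmonoid.closure G = N}

theorem Gn_subset (N : AddSubmonoid ℕ) (G : Set ℕ) (hG : AddSubmonoid.closure G = N) :
    Gn N ⊆ G := Set.sInter_subset_of_mem hG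

theorem closure_Gn (N : AddSubmonoid ℕ) : AddSubmonoid.closure (Gn N) = N := by
  apply le_antisymm
  · rw [AddSubmonoid.closure_le]
    exact Gn_subset N N (AddSubmonoid.closure_eq N)
  · intro n
    induction n using Nat.strong_induction_on with
    | _ n ih =>
      intro hn
      by_cases h : n ∈ Gn N
      · exact AddSubmonoid.subset_closure h
      · simp only [Gn, Set.mem_sInter, Set.mem_ofPred_eq, not_forall] at h
        obtain ⟨G, hG, hnG⟩ := h
        have key : ∀ m ∈ AddSubmonoid.closure G,
            m ≤ n → m ∈ AddSubmonoid.closure (Gn N) := by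
          intro m hm
          induction hm using AddSubmonoid.closure_induction with
          | mem x hx =>
            intro hxn
            have hne : x ≠ n := fun h => hnG (h ▸ hx)
            exact ih x (lt_of_le_of_ne hxn hne) (hG ▸ AddSubmonoid.subset_closure hx)
          | zero => intro _; exact zero_mem _
          | add x y _ _ hx hy => intro h; exact add_mem (hx (by omega)) (hy (by omega))
        exact key n (hG ▸ hn) le_rfl

end InjMonoid

open InjMonoid

/-! Coimage sizes add under composition, so the finite coimage sizes of members of $M$ form an
additive monoid $N$. Two facts then show that a normal $M$ has the stated form.

Factorization (`exists_mul_conj_eq`): if $f$ and $g$ have nonempty coimages whose sizes add up to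
that of $h$, then $h$ is a conjugate of $f$ times a conjugate of $g$. Hence one map with infinite
coimage in $M$ brings in all of them, and if $n=a+b$ with $a,b\in N$ nonzero, every map of coimage
size $n$ is in $M$. Only the sizes in $\mathrm{Gn}(N)$ leave any freedom, and $B$ collects the
members of $M$ of such sizes. To factor $h$, set aside one forward ray of $f$ and one of $g$ and
copy all other cycles sparsely into $\Omega$, using a forward ray of $h$ for room. Countably many
small extensions then complete this to maps $p$, $q$ with $q\circ p=h$, such that all remaining
points form a single ray under $p$ and a single ray under $q$ (`exists_weave`).

Transpositions: a suitable transposition cuts an $n$-cycle out of an infinite cycle and changes no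
other cycle count (`exists_isSplitting`), and the counts determine a map up to conjugacy
(`exists_perm_of_counts`). So if $f\approx_{\mathrm{fin}}g$ and $f$ has an infinite cycle, then up
to conjugacy $g$ is $f$ times finitely many transpositions, whose number has the parity of the sum
defining $\approx_{\mathrm{even}}$. A normal $M$ containing $\mathrm{Alt}(\Omega)$ absorbs even
numbers of transpositions. An odd number is absorbed as well when $f$ is conjugate to $f$ times one
transposition, which happens if $f$ has two infinite cycles (exchange their tails) or infinitely
many $n$-cycles (cut out one more).

Conversely, conjugate maps are $\approx_{\mathrm{even}}$-equivalent, and the three closed subsets of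
$B$ cover $B$ because each of its members has a forward cycle. -/

namespace InjMonoid

open Function Relation

/-! ### Building two factors of a map simultaneously, arrow by arrow -/

section PathSystem

variable {Ω : Type*}

/-- The relation `R` with one more arrow, from `a` to `b`. -/
def addArrow (R : Ω → Ω → Prop) (a b x y : Ω) : Prop := R x y ∨ (x = a ∧ y = b)

/-- `R` is the graph of a partial injection that is defined on the invariant set `F`, and outside of
`F` it consists of finite paths. -/
structure PathSystem (R : Ω → Ω → Prop) (F : Set Ω) : Prop where
  right_unique : ∀ x y z, R x y → R x z → y = z
  left_unique : ∀ x y z, R x z → R y z → x = y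
  mem_iff : ∀ x y, R x y → (x ∈ F ↔ y ∈ F)
  exists_arrow : ∀ x ∈ F, ∃ y, R x y
  exists_start : ∀ x ∉ F, ∃ s, ReflTransGen R s x ∧ ∀ y, ¬ R y s
  exists_end : ∀ x ∉ F, ∃ e, ReflTransGen R x e ∧ ∀ y, ¬ R e y

variable {R : Ω → Ω → Prop} {F : Set Ω}

theorem _root_.Relation.ReflTransGen.addArrow {x y : Ω} (h : ReflTransGen R x y) (a b : Ω) :
    ReflTransGen (InjMonoid.addArrow R a b) x y :=
  ReflTransGen.mono (fun _ _ => Or.inl) _ _ h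

theorem reflTransGen_addArrow {a b x y : Ω} (h : ReflTransGen (addArrow R a b) x y) :
    ReflTransGen R x y ∨ ReflTransGen R x a := by
  induction h with
  | refl => exact Or.inl .refl
  | tail _ hyz ih =>
    rcases ih with ih | ih
    · rcases hyz with hyz | ⟨rfl, rfl⟩
      · exact Or.inl (ih.tail hyz)
      · exact Or.inr ih
    · exact Or.inr ih

theorem eq_of_reflTransGen_of_no_out {x y : Ω} (h : ReflTransGen R x y) (hx : ∀ z, ¬ R x z) :
    x = y := by
  rcases h.cases_head with h | ⟨z, hz, _⟩
  · exact h
  · exact absurd hz (hx z)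

theorem eq_of_reflTransGen_of_no_in {x y : Ω} (h : ReflTransGen R x y) (hy : ∀ z, ¬ R z y) :
    x = y := by
  rcases h.cases_tail with h | ⟨z, _, hz⟩
  · exact h.symm
  · exact absurd hz (hy z)

namespace PathSystem

theorem mem_iff_of_reflTransGen (hR : PathSystem R F) {x y : Ω} (h : ReflTransGen R x y) :
    x ∈ F ↔ y ∈ F := by
  induction h with
  | refl => rfl
  | tail _ hyz ih => exact ih.trans (hR.mem_iff _ _ hyz)

theorem eq_of_starts (hR : PathSystem R F) {s t x : Ω} (hs : ReflTransGen R s x)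
    (ht : ReflTransGen R t x) (hs' : ∀ y, ¬ R y s) (ht' : ∀ y, ¬ R y t) : s = t := by
  induction hs with
  | refl => exact (eq_of_reflTransGen_of_no_in ht hs').symm
  | tail h1 hyz ih =>
    rcases ht.cases_tail with h | ⟨w, hw, hwz⟩
    · subst h; exact absurd hyz (ht' _)
    · rw [hR.left_unique _ _ _ hwz hyz] at hw
      exact ih hw

/-- The new arrow joins the path ending at `a` to the path starting at `b`. By `hba` these are
different paths, so no finite cycle is closed and the joined path still has a start and an end. -/
theorem addArrow (hR : PathSystem R F) {a b : Ω} (ha : a ∉ F) (hb : b ∉ F) (ha' : ∀ y, ¬ R a y)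
    (hb' : ∀ y, ¬ R y b) (hba : ¬ ReflTransGen R b a) : PathSystem (addArrow R a b) F where
  right_unique := by
    rintro x y z (h1 | ⟨rfl, rfl⟩) (h2 | ⟨h3, rfl⟩)
    · exact hR.right_unique _ _ _ h1 h2
    · subst h3; exact absurd h1 (ha' _)
    · exact absurd h2 (ha' _)
    · rfl
  left_unique := by
    rintro x y z (h1 | ⟨rfl, rfl⟩) (h2 | ⟨rfl, h3⟩)
    · exact hR.left_unique _ _ _ h1 h2
    · subst h3; exact absurd h1 (hb' _)
    · exact absurd h2 (hb' _)
    · rfl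
  mem_iff := by
    rintro x y (h1 | ⟨rfl, rfl⟩)
    · exact hR.mem_iff _ _ h1
    · simp [ha, hb]
  exists_arrow x hx := (hR.exists_arrow x hx).imp fun _ => Or.inl
  exists_start x hx := by
    obtain ⟨s, hs, hs'⟩ := hR.exists_start x hx
    by_cases hsb : s = b
    · subst hsb
      obtain ⟨t, ht, ht'⟩ := hR.exists_start a ha
      refine ⟨t, ((ht.addArrow a s).tail (Or.inr ⟨rfl, rfl⟩)).trans (hs.addArrow a s), ?_⟩
      rintro y (h | ⟨rfl, rfl⟩)
      · exact ht' _ h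
      · exact hba ht
    · refine ⟨s, hs.addArrow a b, ?_⟩
      rintro y (h | ⟨rfl, rfl⟩)
      · exact hs' _ h
      · exact hsb rfl
  exists_end x hx := by
    obtain ⟨s, hs, hs'⟩ := hR.exists_end x hx
    by_cases hsa : s = a
    · subst hsa
      obtain ⟨t, ht, ht'⟩ := hR.exists_end b hb
      refine ⟨t, ((hs.addArrow s b).tail (Or.inr ⟨rfl, rfl⟩)).trans (ht.addArrow s b), ?_⟩
      rintro y (h | ⟨rfl, rfl⟩)
      · exact ht' _ h
      · exact hba ht
    · refine ⟨s, hs.addArrow a b, ?_⟩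
      rintro y (h | ⟨rfl, rfl⟩)
      · exact hs' _ h
      · exact hsa rfl

/-- For the initial relations: no two arrows outside `F` are consecutive, so paths there have length
at most one. -/
theorem of_isolated (h1 : ∀ x y z, R x y → R x z → y = z) (h2 : ∀ x y z, R x z → R y z → x = y)
    (h3 : ∀ x y, R x y → (x ∈ F ↔ y ∈ F)) (h4 : ∀ x ∈ F, ∃ y, R x y)
    (h5 : ∀ x y z, x ∉ F → R x y → ¬ R y z) : PathSystem R F where
  right_unique := h1
  left_unique := h2
  mem_iff := h3
  exists_arrow := h4
  exists_start x hx := by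
    by_cases h : ∃ s, R s x
    · obtain ⟨s, hs⟩ := h
      have hsF : s ∉ F := fun h' => hx ((h3 _ _ hs).1 h')
      exact ⟨s, .single hs, fun y hy => h5 y s x (fun h' => hsF ((h3 _ _ hy).1 h')) hy hs⟩
    · exact ⟨x, .refl, fun y hy => h ⟨y, hy⟩⟩
  exists_end x hx := by
    by_cases h : ∃ s, R x s
    · obtain ⟨s, hs⟩ := h
      exact ⟨s, .single hs, fun y hy => h5 x s y hx hs hy⟩
    · exact ⟨x, .refl, fun y hy => h ⟨y, hy⟩⟩

end PathSystem

/-- If `R` is the graph of (a part of) a map `p`, then this is the graph of (a part of) a map `q`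
for which `h x = q (p x)` for all `x`, and `q` is `κ` on the set `P` of points outside of the image
of `p`. -/
def secondArrow (h : Ω → Ω) (P : Set Ω) (κ : Ω → Ω) (R : Ω → Ω → Prop) (y z : Ω) : Prop :=
  (∃ x, R x y ∧ h x = z) ∨ (y ∈ P ∧ κ y = z)

theorem secondArrow_addArrow (h : Ω → Ω) (P : Set Ω) (κ : Ω → Ω) (R : Ω → Ω → Prop) (a b : Ω) :
    secondArrow h P κ (addArrow R a b) = addArrow (secondArrow h P κ R) b (h a) := by
  ext y z
  simp only [secondArrow, addArrow]
  constructor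
  · rintro (⟨x, h1 | ⟨rfl, rfl⟩, h2⟩ | h1)
    · exact Or.inl (Or.inl ⟨x, h1, h2⟩)
    · exact Or.inr ⟨rfl, h2.symm⟩
    · exact Or.inl (Or.inr h1)
  · rintro ((⟨x, h1, h2⟩ | h1) | ⟨rfl, rfl⟩)
    · exact Or.inl ⟨x, Or.inl h1, h2⟩
    · exact Or.inr h1
    · exact Or.inl ⟨a, Or.inr ⟨rfl, rfl⟩, rfl⟩

theorem secondArrow_mono {h : Ω → Ω} {P : Set Ω} {κ : Ω → Ω} {R S : Ω → Ω → Prop}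
    (hRS : ∀ x y, R x y → S x y) {y z : Ω} (hyz : secondArrow h P κ R y z) :
    secondArrow h P κ S y z :=
  hyz.imp (fun ⟨x, h1, h2⟩ => ⟨x, hRS _ _ h1, h2⟩) id

/-- `w` occurs neither in one of the given sets nor in an arrow of one of the two relations. -/
def IsIsolated (P F G : Set Ω) (R Q : Ω → Ω → Prop) (w : Ω) : Prop :=
  w ∉ P ∧ w ∉ F ∧ w ∉ G ∧ ∀ y, ¬ R w y ∧ ¬ R y w ∧ ¬ Q w y ∧ ¬ Q y w

/-- An approximation `R` to a map `p`, such that `h` is the product of `p` and the map that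
is approximated by `secondArrow h P κ R`. -/
structure Weave (h : Ω → Ω) (P : Set Ω) (κ : Ω → Ω) (F G : Set Ω) (R : Ω → Ω → Prop) : Prop where
  fst : PathSystem R F
  snd : PathSystem (secondArrow h P κ R) G
  no_in : ∀ x, ∀ y ∈ P, ¬ R x y
  fst_in : ∀ y ∈ F, y ∉ P → ∃ x, R x y
  snd_in : ∀ x, h x ∈ G → ∃ y, secondArrow h P κ R y (h x)
  fresh : {w | IsIsolated P F G R (secondArrow h P κ R) w ∧
    IsIsolated P F G R (secondArrow h P κ R) (h w) ∧ h w ≠ w}.Infinite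

namespace Weave

variable {h : Ω → Ω} {P G : Set Ω} {κ : Ω → Ω}

/-- Deciding that the first map sends `a` to `b` forces the second to send `b` to `h a`. Both new
arrows have to avoid closing a cycle, which is what `h1` and `h2` say. Only finitely many fresh
points are lost, since `h` is injective. -/
theorem addArrow (hW : Weave h P κ F G R) (hh : Injective h) (hκ : ∀ y ∈ P, ∀ x, κ y ≠ h x)
    {a b : Ω} (ha : ∀ y, ¬ R a y) (hb : ∀ y, ¬ R y b) (hbP : b ∉ P) (h1 : ¬ ReflTransGen R b a)
    (h2 : ¬ ReflTransGen (secondArrow h P κ R) (h a) b) :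
    Weave h P κ F G (addArrow R a b) where
  fst := by
    refine hW.fst.addArrow (fun h' => ?_) (fun h' => ?_) ha hb h1
    · obtain ⟨y, hy⟩ := hW.fst.exists_arrow a h'
      exact ha y hy
    · obtain ⟨y, hy⟩ := hW.fst_in b h' hbP
      exact hb y hy
  snd := by
    rw [secondArrow_addArrow]
    have hb' : ∀ z, ¬ secondArrow h P κ R b z := by
      rintro z (⟨x, hx, _⟩ | ⟨hP, _⟩)
      exacts [hb x hx, hbP hP]
    have ha' : ∀ z, ¬ secondArrow h P κ R z (h a) := by
      rintro z (⟨x, hx, hxa⟩ | ⟨hP, hz⟩)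
      · rw [hh hxa] at hx; exact ha _ hx
      · exact hκ _ hP _ hz
    refine hW.snd.addArrow (fun h' => ?_) (fun h' => ?_) hb' ha' h2
    · obtain ⟨y, hy⟩ := hW.snd.exists_arrow b h'
      exact hb' y hy
    · obtain ⟨y, hy⟩ := hW.snd_in a h'
      exact ha' y hy
  no_in := by
    rintro x y hy (h' | ⟨rfl, rfl⟩)
    exacts [hW.no_in _ _ hy h', hbP hy]
  fst_in y hy hy' := (hW.fst_in y hy hy').imp fun _ => Or.inl
  snd_in x hx := (hW.snd_in x hx).imp fun _ => secondArrow_mono fun _ _ => Or.inl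
  fresh := by
    have hfin : ({a, b, h a} ∪ h ⁻¹' {a, b, h a} : Set Ω).Finite :=
      (Set.toFinite _).union ((Set.toFinite _).preimage hh.injOn)
    have key : ∀ w, IsIsolated P F G R (secondArrow h P κ R) w → w ∉ ({a, b, h a} : Set Ω) →
        IsIsolated P F G (InjMonoid.addArrow R a b)
          (secondArrow h P κ (InjMonoid.addArrow R a b)) w := by
      rintro w ⟨h1, h2, h3, h4⟩ hw
      simp only [Set.mem_insert_iff, Set.mem_singleton_iff, not_or] at hw
      refine ⟨h1, h2, h3, fun y => ?_⟩
      rw [secondArrow_addArrow]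
      simp only [InjMonoid.addArrow]
      have := h4 y
      tauto
    refine (hW.fresh.sdiff hfin).mono ?_
    rintro w ⟨⟨h1, h2, h3⟩, h4⟩
    simp only [Set.mem_union, not_or, Set.mem_preimage] at h4
    exact ⟨key _ h1 h4.1, key _ h2 h4.2, h3⟩

theorem exists_fresh (hW : Weave h P κ F G R) (hh : Injective h) (S : Set Ω) (hS : S.Finite) :
    ∃ w, w ∉ S ∧ h w ∉ S ∧ h w ≠ w ∧ IsIsolated P F G R (secondArrow h P κ R) w ∧
      IsIsolated P F G R (secondArrow h P κ R) (h w) := by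
  obtain ⟨w, ⟨h1, h2, h3⟩, h4⟩ := (hW.fresh.sdiff (hS.union (hS.preimage hh.injOn))).nonempty
  simp only [Set.mem_union, not_or, Set.mem_preimage] at h4
  exact ⟨w, h4.1, h4.2, h3, h1, h2⟩

/-- The path from `r` ends at some `u` and the path of `x` starts at some `s`. A direct arrow from
`u` to `s` could close a cycle in the second relation, so the link goes through a fresh `w`: the
forced arrows `w → h u` and `s → h w` are harmless because `w` and `h w` are isolated. -/
theorem exists_fst (hW : Weave h P κ F G R) (hh : Injective h) (hκ : ∀ y ∈ P, ∀ x, κ y ≠ h x)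
    {r : Ω} (hr : r ∈ P) (hrF : r ∉ F) (hP : ∀ y ∈ P, y ∉ F → y = r) {x : Ω} (hx : x ∉ F) :
    ∃ R', Weave h P κ F G R' ∧ (∀ y z, R y z → R' y z) ∧ ReflTransGen R' r x := by
  obtain ⟨s, hs, hs'⟩ := hW.fst.exists_start x hx
  have hsF : s ∉ F := fun h' => hx ((hW.fst.mem_iff_of_reflTransGen hs).1 h')
  by_cases hsP : s ∈ P
  · rw [hP s hsP hsF] at hs
    exact ⟨R, hW, fun _ _ => id, hs⟩
  obtain ⟨u, hu, hu'⟩ := hW.fst.exists_end r hrF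
  obtain ⟨w, hw, hhw, hwh, hiw, hihw⟩ := hW.exists_fresh hh {u, s, h u} (Set.toFinite _)
  simp only [Set.mem_insert_iff, Set.mem_singleton_iff, not_or] at hw hhw
  have W1 := hW.addArrow hh hκ hu' (fun y => (hiw.2.2.2 y).2.1) hiw.1
    (fun h' => hw.1 (eq_of_reflTransGen_of_no_out h' fun y => (hiw.2.2.2 y).1))
    (fun h' => hw.2.2 (eq_of_reflTransGen_of_no_in h' fun y => (hiw.2.2.2 y).2.2.2).symm)
  have W2 := W1.addArrow (a := w) (b := s) hh hκ ?_ ?_ hsP ?_ ?_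
  · refine ⟨_, W2, fun _ _ h' => Or.inl (Or.inl h'), ?_⟩
    refine (((((hu.addArrow u w).addArrow w s).tail (b := u) (c := w) ?_).tail (c := s) ?_)).trans
      ((hs.addArrow u w).addArrow w s)
    · exact Or.inl (Or.inr ⟨rfl, rfl⟩)
    · exact Or.inr ⟨rfl, rfl⟩
  · rintro y (h' | ⟨h', _⟩)
    exacts [(hiw.2.2.2 y).1 h', hw.1 h']
  · rintro y (h' | ⟨_, h'⟩)
    exacts [hs' _ h', hw.2.1 h'.symm]
  · intro h'
    rcases reflTransGen_addArrow h' with h' | h'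
    · exact hw.2.1 (eq_of_reflTransGen_of_no_in h' fun y => (hiw.2.2.2 y).2.1).symm
    · have := hW.fst.eq_of_starts h' hu hs' fun y => hW.no_in y r hr
      exact hsP (this ▸ hr)
  · rw [secondArrow_addArrow]
    intro h'
    rcases reflTransGen_addArrow h' with h' | h'
    · exact hhw.2.1 (eq_of_reflTransGen_of_no_out h' fun y => (hihw.2.2.2 y).2.2.1)
    · exact hwh (eq_of_reflTransGen_of_no_out h' fun y => (hihw.2.2.2 y).2.2.1)

/-- The counterpart of `exists_fst` for the second relation. Linking `u` to `h a` through `h w`,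
with `w` fresh, is achieved by the arrows `w → u` and `a → h w` of the first relation. -/
theorem exists_snd (hW : Weave h P κ F G R) (hh : Injective h) (hκ : ∀ y ∈ P, ∀ x, κ y ≠ h x)
    {t : Ω} (ht : t ∉ Set.range h) (htP : ∀ y ∈ P, κ y ≠ t) (htG : t ∉ G)
    (hG : ∀ z ∉ Set.range h, z ∉ G → z = t ∨ ∃ y ∈ P, κ y = z) {x : Ω} (hx : x ∉ G) :
    ∃ R', Weave h P κ F G R' ∧ (∀ y z, R y z → R' y z) ∧
      ReflTransGen (secondArrow h P κ R') t x := by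
  obtain ⟨s, hs, hs'⟩ := hW.snd.exists_start x hx
  have hsG : s ∉ G := fun h' => hx ((hW.snd.mem_iff_of_reflTransGen hs).1 h')
  by_cases hsh : s ∈ Set.range h
  swap
  · rcases hG s hsh hsG with rfl | ⟨y, hy, rfl⟩
    · exact ⟨R, hW, fun _ _ => id, hs⟩
    · exact absurd (Or.inr ⟨hy, rfl⟩) (hs' y)
  obtain ⟨a, rfl⟩ := hsh
  obtain ⟨u, hu, hu'⟩ := hW.snd.exists_end t htG
  obtain ⟨w, hw, hhw, hwh, hiw, hihw⟩ := hW.exists_fresh hh {u, a, h a} (Set.toFinite _)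
  simp only [Set.mem_insert_iff, Set.mem_singleton_iff, not_or] at hw hhw
  have ht' : ∀ y, ¬ secondArrow h P κ R y t := by
    rintro y (⟨z, _, hz⟩ | ⟨hy, hy'⟩)
    exacts [ht ⟨z, hz⟩, htP y hy hy']
  have W1 := hW.addArrow (a := w) (b := u) hh hκ (fun y => (hiw.2.2.2 y).1)
    (fun y hy => hu' _ (Or.inl ⟨y, hy, rfl⟩)) (fun hy => hu' _ (Or.inr ⟨hy, rfl⟩))
    (fun h' => hw.1 (eq_of_reflTransGen_of_no_in h' fun y => (hiw.2.2.2 y).2.1).symm)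
    (fun h' => hhw.1 (eq_of_reflTransGen_of_no_out h' fun y => (hihw.2.2.2 y).2.2.1))
  have W2 := W1.addArrow (a := a) (b := h w) hh hκ ?_ ?_ hihw.1 ?_ ?_
  · refine ⟨_, W2, fun _ _ h' => Or.inl (Or.inl h'), ?_⟩
    rw [secondArrow_addArrow, secondArrow_addArrow]
    refine (((((hu.addArrow _ _).addArrow _ _).tail (b := u) (c := h w) ?_).tail
      (c := h a) ?_)).trans ((hs.addArrow _ _).addArrow _ _)
    · exact Or.inl (Or.inr ⟨rfl, rfl⟩)
    · exact Or.inr ⟨rfl, rfl⟩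
  · rintro y (h' | ⟨h', _⟩)
    exacts [hs' y (Or.inl ⟨a, h', rfl⟩), hw.2.1 h'.symm]
  · rintro y (h' | ⟨_, h'⟩)
    exacts [(hihw.2.2.2 y).2.1 h', hhw.1 h']
  · intro h'
    rcases reflTransGen_addArrow h' with h' | h'
    · exact hhw.2.1 (eq_of_reflTransGen_of_no_out h' fun y => (hihw.2.2.2 y).1)
    · exact hwh (eq_of_reflTransGen_of_no_out h' fun y => (hihw.2.2.2 y).1)
  · rw [secondArrow_addArrow]
    intro h'
    rcases reflTransGen_addArrow h' with h' | h'
    · exact hhw.2.2 (eq_of_reflTransGen_of_no_in h' fun y => (hihw.2.2.2 y).2.2.2).symm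
    · exact ht ⟨a, hW.snd.eq_of_starts h' hu hs' ht'⟩

/-- Running through an enumeration of `Ω`, each point outside `F` is attached to the path from `r`
and each point outside `G` to the path from `t`. The union of the resulting chain of relations is
the graph of `p`. -/
theorem exists_maps [Countable Ω] (hW : Weave h P κ F G R) (hh : Injective h)
    (hκ : ∀ y ∈ P, ∀ x, κ y ≠ h x)
    {r : Ω} (hr : r ∈ P) (hrF : r ∉ F) (hP : ∀ y ∈ P, y ∉ F → y = r)
    {t : Ω} (ht : t ∉ Set.range h) (htP : ∀ y ∈ P, κ y ≠ t) (htG : t ∉ G)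
    (hG : ∀ z ∉ Set.range h, z ∉ G → z = t ∨ ∃ y ∈ P, κ y = z) :
    ∃ p q : Ω → Ω, (∀ x, q (p x) = h x) ∧ (∀ x y, R x y → p x = y) ∧
      (∀ y z, secondArrow h P κ R y z → q y = z) ∧
      Injective p ∧ Injective q ∧ r ∉ Set.range p ∧ t ∉ Set.range q ∧
      (∀ x, x ∉ F ↔ ∃ n, p^[n] r = x) ∧ (∀ x, x ∉ G ↔ ∃ n, q^[n] t = x) := by
  have : Nonempty Ω := ⟨r⟩
  obtain ⟨e, he⟩ := exists_surjective_nat Ω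
  have step : ∀ (n : ℕ) (R : {R // Weave h P κ F G R}), ∃ R' : {R // Weave h P κ F G R},
      (∀ y z, R.1 y z → R'.1 y z) ∧ (e n ∉ F → ReflTransGen R'.1 r (e n)) ∧
      (e n ∉ G → ReflTransGen (secondArrow h P κ R'.1) t (e n)) := by
    rintro n ⟨R, hR⟩
    obtain ⟨R1, hR1, h1, h1'⟩ : ∃ R', Weave h P κ F G R' ∧ (∀ y z, R y z → R' y z) ∧
        (e n ∉ F → ReflTransGen R' r (e n)) := by
      by_cases hn : e n ∈ F
      · exact ⟨R, hR, fun _ _ => id, fun h => absurd hn h⟩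
      · obtain ⟨R1, hR1, h1, h1'⟩ := hR.exists_fst hh hκ hr hrF hP hn
        exact ⟨R1, hR1, h1, fun _ => h1'⟩
    obtain ⟨R2, hR2, h2, h2'⟩ : ∃ R', Weave h P κ F G R' ∧ (∀ y z, R1 y z → R' y z) ∧
        (e n ∉ G → ReflTransGen (secondArrow h P κ R') t (e n)) := by
      by_cases hn : e n ∈ G
      · exact ⟨R1, hR1, fun _ _ => id, fun h => absurd hn h⟩
      · obtain ⟨R2, hR2, h2, h2'⟩ := hR1.exists_snd hh hκ ht htP htG hG hn
        exact ⟨R2, hR2, h2, fun _ => h2'⟩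
    exact ⟨⟨R2, hR2⟩, fun y z hyz => h2 _ _ (h1 _ _ hyz), fun hn => ReflTransGen.mono h2 _ _ (h1' hn), h2'⟩
  choose next hnext using step
  let S : ℕ → {R // Weave h P κ F G R} := fun n => Nat.rec ⟨R, hW⟩ next n
  have hmono : ∀ m n, m ≤ n → ∀ y z, (S m).1 y z → (S n).1 y z := by
    intro m n hmn
    induction hmn with
    | refl => exact fun _ _ => id
    | step _ ih => exact fun y z hyz => (hnext _ _).1 _ _ (ih y z hyz)
  let T : Ω → Ω → Prop := fun x y => ∃ n, (S n).1 x y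
  have hST : ∀ n x y, (S n).1 x y → T x y := fun n x y hxy => ⟨n, hxy⟩
  have hTr : ∀ x y z, T x y → T x z → y = z := by
    rintro x y z ⟨m, hm⟩ ⟨n, hn⟩
    exact (S (max m n)).2.fst.right_unique x y z (hmono _ _ (le_max_left m n) _ _ hm)
      (hmono _ _ (le_max_right m n) _ _ hn)
  have hTl : ∀ x y z, T x z → T y z → x = y := by
    rintro x y z ⟨m, hm⟩ ⟨n, hn⟩
    exact (S (max m n)).2.fst.left_unique x y z (hmono _ _ (le_max_left m n) _ _ hm)
      (hmono _ _ (le_max_right m n) _ _ hn)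
  have hTP : ∀ x, ∀ y ∈ P, ¬ T x y := fun x y hy ⟨n, hn⟩ => (S n).2.no_in x y hy hn
  have hQT : ∀ y z, secondArrow h P κ T y z → ∃ n, secondArrow h P κ (S n).1 y z := by
    rintro y z (⟨x, ⟨n, hn⟩, hx⟩ | h')
    exacts [⟨n, Or.inl ⟨x, hn, hx⟩⟩, ⟨0, Or.inr h'⟩]
  have hQmono : ∀ m n, m ≤ n → ∀ y z, secondArrow h P κ (S m).1 y z →
      secondArrow h P κ (S n).1 y z := fun m n hmn y z => secondArrow_mono (hmono m n hmn)
  have hQr : ∀ x y z, secondArrow h P κ T x y → secondArrow h P κ T x z → y = z := by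
    intro x y z h1 h2
    obtain ⟨m, hm⟩ := hQT _ _ h1
    obtain ⟨n, hn⟩ := hQT _ _ h2
    exact (S (max m n)).2.snd.right_unique x y z (hQmono _ _ (le_max_left m n) _ _ hm)
      (hQmono _ _ (le_max_right m n) _ _ hn)
  have hQl : ∀ x y z, secondArrow h P κ T x z → secondArrow h P κ T y z → x = y := by
    intro x y z h1 h2
    obtain ⟨m, hm⟩ := hQT _ _ h1
    obtain ⟨n, hn⟩ := hQT _ _ h2
    exact (S (max m n)).2.snd.left_unique x y z (hQmono _ _ (le_max_left m n) _ _ hm)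
      (hQmono _ _ (le_max_right m n) _ _ hn)
  have hF : ∀ x ∉ F, ReflTransGen T r x := by
    intro x hx
    obtain ⟨n, rfl⟩ := he x
    exact ReflTransGen.mono (hST (n + 1)) _ _ ((hnext n (S n)).2.1 hx)
  have hG' : ∀ x ∉ G, ReflTransGen (secondArrow h P κ T) t x := by
    intro x hx
    obtain ⟨n, rfl⟩ := he x
    exact ReflTransGen.mono (fun _ _ => secondArrow_mono (hST (n + 1))) _ _ ((hnext n (S n)).2.2 hx)
  -- The point `h x` is not `t`, so some arrow of the second relation enters it. As `κ` avoids the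
  -- range of `h`, that arrow arises from an arrow of `T`, which must start at `x` by injectivity of
  -- `h`.
  have htot : ∀ x, ∃ y, T x y := by
    intro x
    have : ∃ y, secondArrow h P κ T y (h x) := by
      by_cases hx : h x ∈ G
      · exact (hW.snd_in x hx).imp fun _ => secondArrow_mono (hST 0)
      · rcases (hG' _ hx).cases_tail with h' | ⟨y, _, hy⟩
        · exact absurd ⟨x, h'⟩ ht
        · exact ⟨y, hy⟩
    obtain ⟨y, ⟨x', hx', hxx⟩ | ⟨hy, hy'⟩⟩ := this
    · exact ⟨y, hh hxx ▸ hx'⟩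
    · exact absurd hy' (hκ y hy x)
  have hQtot : ∀ y, ∃ z, secondArrow h P κ T y z := by
    intro y
    by_cases hyP : y ∈ P
    · exact ⟨_, Or.inr ⟨hyP, rfl⟩⟩
    have : ∃ x, T x y := by
      by_cases hy : y ∈ F
      · exact (hW.fst_in y hy hyP).imp fun _ => hST 0 _ _
      · rcases (hF _ hy).cases_tail with h' | ⟨x, _, hx⟩
        · exact absurd (h' ▸ hr) hyP
        · exact ⟨x, hx⟩
    obtain ⟨x, hx⟩ := this
    exact ⟨_, Or.inl ⟨x, hx, rfl⟩⟩
  choose p hp using htot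
  choose q hq using hQtot
  refine ⟨p, q, fun x => ?_, fun x y hxy => ?_, fun y z hyz => ?_, ?_, ?_, ?_, ?_, ?_, ?_⟩
  · exact hQr _ _ _ (hq (p x)) (Or.inl ⟨x, hp x, rfl⟩)
  · exact hTr _ _ _ (hp x) (hST 0 _ _ hxy)
  · exact hQr _ _ _ (hq y) (secondArrow_mono (hST 0) hyz)
  · intro x y hxy
    exact hTl _ _ _ (hp x) (hxy ▸ hp y)
  · intro x y hxy
    exact hQl _ _ _ (hq x) (hxy ▸ hq y)
  · rintro ⟨x, hx⟩
    exact hTP x r hr (hx ▸ hp x)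
  · rintro ⟨x, hx⟩
    rcases hx ▸ hq x with ⟨y, _, hy⟩ | ⟨hy, hy'⟩
    · exact ht ⟨y, hy⟩
    · exact htP _ hy hy'
  · intro x
    constructor
    · intro hx
      have := hF x hx
      induction this with
      | refl => exact ⟨0, rfl⟩
      | @tail y z _ hyz ih =>
        obtain ⟨n, hn⟩ := ih (fun hy => hx (by
          obtain ⟨m, hm⟩ := hyz
          exact ((S m).2.fst.mem_iff _ _ hm).1 hy))
        refine ⟨n + 1, ?_⟩
        rw [iterate_succ_apply', hn]
        exact hTr _ _ _ (hp y) hyz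
    · rintro ⟨n, rfl⟩
      induction n with
      | zero => exact hrF
      | succ n ih =>
        rw [iterate_succ_apply']
        obtain ⟨m, hm⟩ := hp (p^[n] r)
        rwa [← (S m).2.fst.mem_iff _ _ hm]
  · intro x
    constructor
    · intro hx
      have := hG' x hx
      induction this with
      | refl => exact ⟨0, rfl⟩
      | @tail y z _ hyz ih =>
        obtain ⟨n, hn⟩ := ih (fun hy => hx (by
          obtain ⟨m, hm⟩ := hQT _ _ hyz
          exact ((S m).2.snd.mem_iff _ _ hm).1 hy))
        refine ⟨n + 1, ?_⟩
        rw [iterate_succ_apply', hn]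
        exact hQr _ _ _ (hq y) hyz
    · rintro ⟨n, rfl⟩
      induction n with
      | zero => exact htG
      | succ n ih =>
        rw [iterate_succ_apply']
        obtain ⟨m, hm⟩ := hQT _ _ (hq (q^[n] t))
        rwa [← (S m).2.snd.mem_iff _ _ hm]

end Weave

end PathSystem

/-! ### Factoring a map into conjugates of two given maps -/

section Product

variable {Ω : Type*}

theorem iterate_injective_of_notMem_range {f : Ω → Ω} (hf : Injective f) {a : Ω}
    (ha : a ∉ Set.range f) : Injective fun n => f^[n] a := by
  have key : ∀ m k, f^[m] a = f^[m + (k + 1)] a → False := by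
    intro m k h
    rw [iterate_add_apply] at h
    have := hf.iterate m h
    rw [iterate_succ_apply'] at this
    exact ha ⟨_, this.symm⟩
  intro m n hmn
  rcases lt_trichotomy m n with h | h | h
  · obtain ⟨k, rfl⟩ := Nat.exists_eq_add_of_lt h
    exact (key m k hmn).elim
  · exact h
  · obtain ⟨k, rfl⟩ := Nat.exists_eq_add_of_lt h
    exact (key n k hmn.symm).elim

/-- The conjugating permutation is `φ` off the forward ray of `a` and carries that ray onto the ray
of `r`, which by `hF` is exactly the complement of the image of `φ`. -/
theorem exists_perm_of_ray {f p : Ω → Ω} (hf : Injective f) (hp : Injective p) {a r : Ω}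
    (ha : a ∉ Set.range f) (hr : r ∉ Set.range p) {φ : Ω → Ω}
    (hφ : Set.InjOn φ {u | ∀ n, f^[n] a ≠ u})
    (hfp : ∀ u, (∀ n, f^[n] a ≠ u) → p (φ u) = φ (f u))
    (hF : ∀ x, x ∉ φ '' {u | ∀ n, f^[n] a ≠ u} ↔ ∃ n, p^[n] r = x) :
    ∃ s : Equiv.Perm Ω, ∀ u, s (f u) = p (s u) := by
  classical
  let Φ : Ω → Ω := fun u => if h : ∃ n, f^[n] a = u then p^[h.choose] r else φ u
  have h1 : ∀ n, Φ (f^[n] a) = p^[n] r := by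
    intro n
    have h : ∃ m, f^[m] a = f^[n] a := ⟨n, rfl⟩
    have h' : h.choose = n := iterate_injective_of_notMem_range hf ha h.choose_spec
    simp only [Φ, dif_pos h, h']
  have h2 : ∀ u, (∀ n, f^[n] a ≠ u) → Φ u = φ u := fun u hu => dif_neg (not_exists.2 hu)
  have hinj : Injective Φ := by
    intro u v huv
    by_cases hu : ∃ n, f^[n] a = u <;> by_cases hv : ∃ n, f^[n] a = v
    · obtain ⟨m, rfl⟩ := hu
      obtain ⟨n, rfl⟩ := hv
      rw [h1, h1] at huv
      rw [iterate_injective_of_notMem_range hp hr huv]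
    · obtain ⟨m, rfl⟩ := hu
      rw [h1, h2 v (not_exists.1 hv)] at huv
      exact absurd ⟨v, not_exists.1 hv, rfl⟩ ((hF _).2 ⟨m, huv⟩)
    · obtain ⟨m, rfl⟩ := hv
      rw [h1, h2 u (not_exists.1 hu)] at huv
      exact absurd ⟨u, not_exists.1 hu, rfl⟩ ((hF _).2 ⟨m, huv.symm⟩)
    · rw [h2 v (not_exists.1 hv), h2 u (not_exists.1 hu)] at huv
      exact hφ (not_exists.1 hu) (not_exists.1 hv) huv
  have hsurj : Surjective Φ := by
    intro x
    by_cases hx : x ∈ φ '' {u | ∀ n, f^[n] a ≠ u}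
    · obtain ⟨u, hu, rfl⟩ := hx
      exact ⟨u, h2 u hu⟩
    · obtain ⟨n, rfl⟩ := (hF x).1 hx
      exact ⟨_, h1 n⟩
  have hbij : Bijective Φ := ⟨hinj, hsurj⟩
  refine ⟨Equiv.ofBijective Φ hbij, fun u => ?_⟩
  change Φ (f u) = p (Φ u)
  by_cases hu : ∃ n, f^[n] a = u
  · obtain ⟨n, rfl⟩ := hu
    rw [h1, ← iterate_succ_apply' f, h1, iterate_succ_apply']
  · have hu := not_exists.1 hu
    rw [h2 u hu, h2, hfp u hu]
    intro n
    cases n with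
    | zero => exact fun h => ha ⟨u, h.symm⟩
    | succ n =>
      rw [iterate_succ_apply']
      exact fun h => hu n (hf h)

theorem exists_weave [Countable Ω] {f g h : Ω → Ω} (hf : Injective f) (hg : Injective g)
    (hh : Injective h) {κ₁ κ₂ : Ω → Ω} (hκ₁ : Set.InjOn κ₁ (Set.range f)ᶜ)
    (hκ₂ : Set.InjOn κ₂ (Set.range g)ᶜ)
    (hκ : κ₁ '' (Set.range f)ᶜ ∪ κ₂ '' (Set.range g)ᶜ = (Set.range h)ᶜ)
    (hdisj : Disjoint (κ₁ '' (Set.range f)ᶜ) (κ₂ '' (Set.range g)ᶜ))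
    {a b : Ω} (ha : a ∉ Set.range f) (hb : b ∉ Set.range g) :
    ∃ p q : Ω → Ω, (∀ x, q (p x) = h x) ∧ (∃ s : Equiv.Perm Ω, ∀ u, s (f u) = p (s u)) ∧
      ∃ s : Equiv.Perm Ω, ∀ u, s (g u) = q (s u) := by
  classical
  have hne : Nonempty Ω := ⟨a⟩
  have hκ₁' : ∀ u ∉ Set.range f, κ₁ u ∉ Set.range h := fun u hu =>
    hκ.subset (Or.inl ⟨u, hu, rfl⟩)
  have hκ₂' : ∀ u ∉ Set.range g, κ₂ u ∉ Set.range h := fun u hu =>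
    hκ.subset (Or.inr ⟨u, hu, rfl⟩)
  have hκ₁₂ : ∀ u ∉ Set.range f, ∀ v ∉ Set.range g, κ₁ u ≠ κ₂ v := fun u hu v hv =>
    Set.disjoint_iff_forall_ne.1 hdisj ⟨u, hu, rfl⟩ ⟨v, hv, rfl⟩
  obtain ⟨e, he⟩ := exists_injective_nat Ω
  -- A forward ray of `h` provides the room. Only `c 0` lies outside the range of `h`, so points of
  -- positive index never meet the values of `κ₁` and `κ₂`.
  obtain ⟨c, hc, hhc, hcm⟩ : ∃ c : ℕ → Ω, Injective c ∧ (∀ n, h (c n) = c (n + 1)) ∧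
      ∀ n, c (n + 1) ∈ Set.range h :=
    ⟨fun n => h^[n] (κ₁ a), iterate_injective_of_notMem_range hh (hκ₁' a ha),
      fun n => (iterate_succ_apply' h n _).symm, fun n => ⟨_, (iterate_succ_apply' h n _).symm⟩⟩
  have hcκ₁ : ∀ n, ∀ u ∉ Set.range f, c (n + 1) ≠ κ₁ u := fun n u hu hn => hκ₁' u hu (hn ▸ hcm n)
  have hcκ₂ : ∀ n, ∀ u ∉ Set.range g, c (n + 1) ≠ κ₂ u := fun n u hu hn => hκ₂' u hu (hn ▸ hcm n)
  -- Indices modulo 9 keep the roles apart: 1 for copies of points under `φ`, 2 for their images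
  -- under `h`, 5 for copies of the range of `g` under `ψ`, 4 for the `h`-preimages of these, and 6,
  -- 7 for fresh points and their images.
  obtain ⟨φ, hφ⟩ : ∃ φ : Ω → Ω, ∀ u, φ u = c (9 * e u + 1) := ⟨_, fun _ => rfl⟩
  have hφi : Injective φ := by
    intro u v huv
    rw [hφ, hφ] at huv
    exact he (by have := hc huv; omega)
  obtain ⟨ψ, hψ, hψ'⟩ : ∃ ψ : Ω → Ω, (∀ v ∉ Set.range g, ψ v = κ₂ v) ∧
      ∀ v, ψ (g v) = c (9 * e (g v) + 5) :=
    ⟨fun v => if v ∈ Set.range g then c (9 * e v + 5) else κ₂ v, fun v hv => if_neg hv,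
      fun v => if_pos ⟨v, rfl⟩⟩
  have hψi : Injective ψ := by
    intro u v huv
    by_cases hu : u ∈ Set.range g <;> by_cases hv : v ∈ Set.range g
    · obtain ⟨u, rfl⟩ := hu
      obtain ⟨v, rfl⟩ := hv
      rw [hψ', hψ'] at huv
      exact he (by have := hc huv; omega)
    · obtain ⟨u, rfl⟩ := hu
      rw [hψ', hψ v hv] at huv
      exact absurd huv (hcκ₂ _ v hv)
    · obtain ⟨v, rfl⟩ := hv
      rw [hψ', hψ u hu] at huv
      exact absurd huv.symm (hcκ₂ _ u hu)
    · rw [hψ u hu, hψ v hv] at huv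
      exact hκ₂ hu hv huv
  have hψc : ∀ v n, ψ v = c (n + 1) → n + 1 = 9 * e v + 5 := by
    intro v n hv
    by_cases hv' : v ∈ Set.range g
    · obtain ⟨v, rfl⟩ := hv'
      rw [hψ'] at hv
      exact (hc hv).symm
    · rw [hψ v hv'] at hv
      exact absurd hv.symm (hcκ₂ _ _ hv')
  have hφψ : ∀ u v, φ u ≠ ψ v := by
    intro u v huv
    rw [hφ] at huv
    have := hψc _ _ huv.symm
    omega
  have hφh : ∀ u, h (φ u) = c (9 * e u + 2) := fun u => by rw [hφ, hhc]
  let X : Set Ω := {u | ∀ n, f^[n] a ≠ u}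
  let Y : Set Ω := {u | ∀ n, g^[n] b ≠ u}
  have hX : ∀ u, f u ∈ X ↔ u ∈ X := by
    refine fun u => ⟨fun hu n hn => hu (n + 1) ?_, fun hu n hn => ?_⟩
    · rw [iterate_succ_apply', hn]
    · cases n with
      | zero => exact ha ⟨u, hn.symm⟩
      | succ n =>
        rw [iterate_succ_apply'] at hn
        exact hu n (hf hn)
  have hY : ∀ u, g u ∈ Y ↔ u ∈ Y := by
    refine fun u => ⟨fun hu n hn => hu (n + 1) ?_, fun hu n hn => ?_⟩
    · rw [iterate_succ_apply', hn]
    · cases n with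
      | zero => exact hb ⟨u, hn.symm⟩
      | succ n =>
        rw [iterate_succ_apply'] at hn
        exact hu n (hg hn)
  have haX : ∀ u ∉ Set.range f, u ∉ X → u = a := by
    intro u hu hu'
    simp only [X, Set.mem_ofPred_eq, not_forall, not_not] at hu'
    obtain ⟨n, rfl⟩ := hu'
    cases n with
    | zero => rfl
    | succ n => exact absurd ⟨_, (iterate_succ_apply' f n a).symm⟩ hu
  have hbY : ∀ u ∉ Set.range g, u ∉ Y → u = b := by
    intro u hu hu'
    simp only [Y, Set.mem_ofPred_eq, not_forall, not_not] at hu'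
    obtain ⟨n, rfl⟩ := hu'
    cases n with
    | zero => rfl
    | succ n => exact absurd ⟨_, (iterate_succ_apply' g n b).symm⟩ hu
  let P : Set Ω := φ '' (Set.range f)ᶜ
  let κ : Ω → Ω := fun y => κ₁ (invFun φ y)
  have hκφ : ∀ u, κ (φ u) = κ₁ u := fun u => congrArg κ₁ (leftInverse_invFun hφi u)
  -- The first kind of arrow makes `p` copy `f` on `X`. The second makes `q` copy `g` on `Y`: the
  -- source is the `h`-preimage of `ψ (g v)`, so `q` has to send `ψ v` to `ψ (g v)`.
  let R : Ω → Ω → Prop := fun x y => (∃ u ∈ X, φ u = x ∧ φ (f u) = y) ∨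
    ∃ v ∈ Y, c (9 * e (g v) + 4) = x ∧ ψ v = y
  have hQ : ∀ y z, secondArrow h P κ R y z ↔ (∃ u ∈ X, φ (f u) = y ∧ c (9 * e u + 2) = z) ∨
      (∃ v ∈ Y, ψ v = y ∧ ψ (g v) = z) ∨ ∃ u ∉ Set.range f, φ u = y ∧ κ₁ u = z := by
    intro y z
    constructor
    · rintro (⟨x, ⟨u, hu, rfl, rfl⟩ | ⟨v, hv, rfl, rfl⟩, rfl⟩ | ⟨⟨u, hu, rfl⟩, rfl⟩)
      · exact Or.inl ⟨u, hu, rfl, (hφh u).symm⟩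
      · exact Or.inr (Or.inl ⟨v, hv, rfl, by rw [hψ', hhc]⟩)
      · exact Or.inr (Or.inr ⟨u, hu, rfl, (hκφ u).symm⟩)
    · rintro (⟨u, hu, rfl, rfl⟩ | ⟨v, hv, rfl, rfl⟩ | ⟨u, hu, rfl, rfl⟩)
      · exact Or.inl ⟨_, Or.inl ⟨u, hu, rfl, rfl⟩, hφh u⟩
      · exact Or.inl ⟨_, Or.inr ⟨v, hv, rfl, rfl⟩, by rw [hψ', hhc]⟩
      · exact Or.inr ⟨⟨u, hu, rfl⟩, hκφ u⟩
  have hφc : ∀ u n, φ u = c n → n = 9 * e u + 1 := fun u n hn => by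
    rw [hφ] at hn
    exact (hc hn).symm
  have hfst : PathSystem R (φ '' X) := by
    refine PathSystem.of_isolated ?_ ?_ ?_ ?_ ?_
    · rintro x y z (⟨u, hu, rfl, rfl⟩ | ⟨v, hv, rfl, rfl⟩) (⟨u', hu', h1, rfl⟩ | ⟨v', hv', h1, rfl⟩)
      · rw [hφi h1]
      · have := hφc _ _ h1.symm; omega
      · have := hφc _ _ h1; omega
      · have := hc h1
        rw [hg (he (by omega : e (g v') = e (g v)))]
    · rintro x y z (⟨u, hu, rfl, rfl⟩ | ⟨v, hv, rfl, rfl⟩) (⟨u', hu', rfl, h1⟩ | ⟨v', hv', rfl, h1⟩)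
      · rw [hf (hφi h1)]
      · exact absurd h1.symm (hφψ _ _)
      · exact absurd h1 (hφψ _ _)
      · rw [hψi h1]
    · rintro x y (⟨u, hu, rfl, rfl⟩ | ⟨v, hv, rfl, rfl⟩)
      · exact iff_of_true ⟨u, hu, rfl⟩ ⟨f u, (hX u).2 hu, rfl⟩
      · refine iff_of_false ?_ ?_
        · rintro ⟨u, _, hu⟩
          have := hφc _ _ hu; omega
        · rintro ⟨u, _, hu⟩
          exact hφψ _ _ hu
    · rintro _ ⟨u, hu, rfl⟩
      exact ⟨_, Or.inl ⟨u, hu, rfl, rfl⟩⟩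
    · rintro x y z hx (⟨u, hu, rfl, rfl⟩ | ⟨v, hv, rfl, rfl⟩)
      · exact absurd ⟨u, hu, rfl⟩ hx
      · rintro (⟨u', hu', h1, rfl⟩ | ⟨v', hv', h1, rfl⟩)
        · exact hφψ _ _ h1
        · have := hψc _ _ h1.symm; omega
  have hsnd : PathSystem (secondArrow h P κ R) (ψ '' Y) := by
    refine PathSystem.of_isolated ?_ ?_ ?_ ?_ ?_ <;> simp only [hQ]
    · rintro x y z (⟨u, hu, rfl, rfl⟩ | ⟨v, hv, rfl, rfl⟩ | ⟨u, hu, rfl, rfl⟩)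
        (⟨u', hu', h1, rfl⟩ | ⟨v', hv', h1, rfl⟩ | ⟨u', hu', h1, rfl⟩)
      · rw [hf (hφi h1)]
      · exact absurd h1.symm (hφψ _ _)
      · exact absurd ⟨_, (hφi h1).symm⟩ hu'
      · exact absurd h1 (hφψ _ _)
      · rw [hψi h1]
      · exact absurd h1 (hφψ _ _)
      · exact absurd ⟨_, hφi h1⟩ hu
      · exact absurd h1.symm (hφψ _ _)
      · rw [hφi h1]
    · rintro x y z (⟨u, hu, rfl, rfl⟩ | ⟨v, hv, rfl, rfl⟩ | ⟨u, hu, rfl, rfl⟩)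
        (⟨u', hu', rfl, h1⟩ | ⟨v', hv', rfl, h1⟩ | ⟨u', hu', rfl, h1⟩)
      · have := hc h1
        rw [he (by omega : e u' = e u)]
      · have := hψc _ _ h1; omega
      · exact absurd h1.symm (hcκ₁ _ _ hu')
      · have := hψc _ _ h1.symm; omega
      · rw [hg (hψi h1)]
      · rw [hψ'] at h1; exact absurd h1.symm (hcκ₁ _ _ hu')
      · exact absurd h1 (hcκ₁ _ _ hu)
      · rw [hψ'] at h1; exact absurd h1 (hcκ₁ _ _ hu)
      · rw [hκ₁ hu hu' h1.symm]
    · rintro x y (⟨u, hu, rfl, rfl⟩ | ⟨v, hv, rfl, rfl⟩ | ⟨u, hu, rfl, rfl⟩)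
      · refine iff_of_false ?_ ?_
        · rintro ⟨v, _, hv⟩
          exact hφψ _ _ hv.symm
        · rintro ⟨v, _, hv⟩
          have := hψc _ _ hv; omega
      · exact iff_of_true ⟨v, hv, rfl⟩ ⟨g v, (hY v).2 hv, rfl⟩
      · refine iff_of_false ?_ ?_
        · rintro ⟨v, _, hv⟩
          exact hφψ _ _ hv.symm
        · rintro ⟨v, _, hv⟩
          by_cases hv' : v ∈ Set.range g
          · obtain ⟨v, rfl⟩ := hv'
            rw [hψ'] at hv
            exact hcκ₁ _ _ hu hv
          · rw [hψ v hv'] at hv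
            exact hκ₁₂ _ hu _ hv' hv.symm
    · rintro _ ⟨v, hv, rfl⟩
      exact ⟨_, Or.inr (Or.inl ⟨v, hv, rfl, rfl⟩)⟩
    · rintro x y z hx (⟨u, hu, rfl, rfl⟩ | ⟨v, hv, rfl, rfl⟩ | ⟨u, hu, rfl, rfl⟩)
      · rintro (⟨u', hu', h1, rfl⟩ | ⟨v', hv', h1, rfl⟩ | ⟨u', hu', h1, rfl⟩)
        · have := hφc _ _ h1; omega
        · have := hψc _ _ h1; omega
        · have := hφc _ _ h1; omega
      · exact absurd ⟨v, hv, rfl⟩ hx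
      · have h0 : ∀ u', φ u' ≠ κ₁ u := fun u' h1 => by
          rw [hφ] at h1
          exact hcκ₁ _ _ hu h1
        rintro (⟨u', hu', h1, rfl⟩ | ⟨v', hv', h1, rfl⟩ | ⟨u', hu', h1, rfl⟩)
        · exact h0 _ h1
        · by_cases hv' : v' ∈ Set.range g
          · obtain ⟨v, rfl⟩ := hv'
            rw [hψ'] at h1
            exact hcκ₁ _ _ hu h1
          · rw [hψ _ hv'] at h1
            exact hκ₁₂ _ hu _ hv' h1.symm
        · exact h0 _ h1
  have hiso : ∀ n, n % 9 = 6 ∨ n % 9 = 7 →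
      IsIsolated P (φ '' X) (ψ '' Y) R (secondArrow h P κ R) (c n) := by
    intro n hn
    obtain ⟨m, rfl⟩ : ∃ m, n = m + 1 := ⟨n - 1, by omega⟩
    have h1 : ∀ u, φ u ≠ c (m + 1) := fun u hu => by have := hφc _ _ hu; omega
    have h2 : ∀ u, ψ u ≠ c (m + 1) := fun u hu => by have := hψc _ _ hu; omega
    refine ⟨?_, ?_, ?_, fun y => ⟨?_, ?_, ?_, ?_⟩⟩
    · rintro ⟨u, _, hu⟩; exact h1 _ hu
    · rintro ⟨u, _, hu⟩; exact h1 _ hu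
    · rintro ⟨u, _, hu⟩; exact h2 _ hu
    · rintro (⟨u, hu, h3, rfl⟩ | ⟨v, hv, h3, rfl⟩)
      · exact h1 _ h3
      · have := hc h3; omega
    · rintro (⟨u, hu, _, h3⟩ | ⟨v, hv, _, h3⟩)
      · exact h1 _ h3
      · exact h2 _ h3
    · rw [hQ]
      rintro (⟨u', hu', h3, rfl⟩ | ⟨v', hv', h3, rfl⟩ | ⟨u', hu', h3, rfl⟩)
      exacts [h1 _ h3, h2 _ h3, h1 _ h3]
    · rw [hQ]
      rintro (⟨u', hu', _, h3⟩ | ⟨v', hv', _, h3⟩ | ⟨u', hu', _, h3⟩)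
      · have := hc h3; omega
      · exact h2 _ h3
      · exact hcκ₁ _ _ hu' h3.symm
  have hW : Weave h P κ (φ '' X) (ψ '' Y) R := by
    refine ⟨hfst, hsnd, ?_, ?_, ?_, ?_⟩
    · rintro x _ ⟨u, hu, rfl⟩ (⟨u', hu', _, h3⟩ | ⟨v, hv, _, h3⟩)
      · exact hu ⟨u', hφi h3⟩
      · exact hφψ _ _ h3.symm
    · rintro _ ⟨u, hu, rfl⟩ hu'
      have : u ∈ Set.range f := by
        by_contra hu''
        exact hu' ⟨u, hu'', rfl⟩
      obtain ⟨u, rfl⟩ := this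
      exact ⟨_, Or.inl ⟨u, (hX u).1 hu, rfl, rfl⟩⟩
    · rintro x ⟨v, hv, hvx⟩
      have : v ∈ Set.range g := by
        by_contra hv'
        rw [hψ v hv'] at hvx
        exact hκ₂' v hv' ⟨x, hvx.symm⟩
      obtain ⟨v, rfl⟩ := this
      exact ⟨ψ v, (hQ _ _).2 (Or.inr (Or.inl ⟨v, (hY v).1 hv, rfl, hvx⟩))⟩
    · refine Set.infinite_of_injective_forall_mem (f := fun n => c (9 * n + 6)) ?_ ?_
      · intro m n hmn
        have := hc hmn
        omega
      · intro n
        refine ⟨hiso _ (by omega), ?_, ?_⟩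
        · rw [hhc]; exact hiso _ (by omega)
        · rw [hhc]
          intro h1
          have := hc h1
          omega
  have haX' : a ∉ X := fun h' => h' 0 rfl
  have hbY' : b ∉ Y := fun h' => h' 0 rfl
  obtain ⟨p, q, hqp, hpR, hqR, hpi, hqi, hrp, htq, hpF, hqG⟩ := hW.exists_maps (r := φ a)
    (t := ψ b) hh
    (by
      rintro _ ⟨u, hu, rfl⟩ x hx
      rw [hκφ] at hx
      exact hκ₁' u hu ⟨x, hx.symm⟩)
    ⟨a, ha, rfl⟩
    (by
      rintro ⟨u, hu, hu'⟩
      exact haX' (hφi hu' ▸ hu))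
    (by
      rintro _ ⟨u, hu, rfl⟩ hu'
      rw [haX u hu fun h' => hu' ⟨u, h', rfl⟩])
    (by
      rw [hψ b hb]
      exact hκ₂' b hb)
    (by
      rintro _ ⟨u, hu, rfl⟩
      rw [hκφ, hψ b hb]
      exact hκ₁₂ _ hu _ hb)
    (by
      rintro ⟨u, hu, hu'⟩
      exact hbY' (hψi hu' ▸ hu))
    (by
      intro z hz hz'
      rcases hκ.superset hz with ⟨u, hu, rfl⟩ | ⟨v, hv, rfl⟩
      · exact Or.inr ⟨φ u, ⟨u, hu, rfl⟩, hκφ u⟩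
      · rw [← hψ v hv] at hz' ⊢
        rw [hbY v hv fun h' => hz' ⟨v, h', rfl⟩]
        exact Or.inl rfl)
  refine ⟨p, q, hqp, ?_, ?_⟩
  · exact exists_perm_of_ray hf hpi ha hrp hφi.injOn
      (fun u hu => hpR _ _ (Or.inl ⟨u, hu, rfl, rfl⟩)) hpF
  · exact exists_perm_of_ray hg hqi hb htq hψi.injOn
      (fun u hu => hqR _ _ ((hQ _ _).2 (Or.inr (Or.inl ⟨u, hu, rfl, rfl⟩)))) hqG

theorem nonempty_equiv_of_encard_eq {α β : Type*} {s : Set α} {t : Set β} (hs : s.Countable)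
    (ht : t.Countable) (h : s.encard = t.encard) : Nonempty (s ≃ t) := by
  have hs' := hs.to_subtype
  have ht' := ht.to_subtype
  by_cases hf : s.Finite
  · have hf' : t.Finite := by rwa [← Set.encard_lt_top_iff, ← h, Set.encard_lt_top_iff]
    have := hf.to_subtype
    have := hf'.to_subtype
    refine ⟨(Finite.card_eq.1 ?_).some⟩
    rw [Nat.card_coe_set_eq, Nat.card_coe_set_eq, Set.ncard, Set.ncard, h]
  · have hf' : t.Infinite := by rwa [← Set.encard_eq_top_iff, ← h, Set.encard_eq_top_iff]
    have hf := Set.Infinite.to_subtype hf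
    exact ⟨(nonempty_denumerable_iff.2 ⟨hs', hf⟩).some.eqv.trans
      (nonempty_denumerable_iff.2 ⟨ht', hf'.to_subtype⟩).some.eqv.symm⟩

/-- By `hd` the coimage of `h` splits into copies of the coimages of `f` and `g`. These supply the
maps `κ₁` and `κ₂` of `exists_weave`, and the factors found there are conjugate to `f` and `g`. -/
theorem exists_mul_conj_eq [Countable Ω] {f g h : Inj Ω} (hf : (coimage f).Nonempty)
    (hg : (coimage g).Nonempty)
    (hd : (coimage f).encard + (coimage g).encard = (coimage h).encard) :
    ∃ a b : Equiv.Perm Ω, ((a.toEmbedding : Inj Ω) * f * (a.symm.toEmbedding : Inj Ω)) *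
      ((b.toEmbedding : Inj Ω) * g * (b.symm.toEmbedding : Inj Ω)) = h := by
  classical
  obtain ⟨a, ha⟩ := hf
  obtain ⟨b, hb⟩ := hg
  let S : Set (Ω ⊕ Ω) := Sum.inl '' coimage f ∪ Sum.inr '' coimage g
  have hS : S.encard = (coimage h).encard := by
    rw [← hd, Set.encard_union_eq, Sum.inl_injective.encard_image, Sum.inr_injective.encard_image]
    rw [Set.disjoint_iff_forall_ne]
    rintro _ ⟨u, _, rfl⟩ _ ⟨v, _, rfl⟩
    simp
  obtain ⟨E⟩ := nonempty_equiv_of_encard_eq S.to_countable (coimage h).to_countable hS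
  let κ : Ω ⊕ Ω → Ω := fun u => if hu : u ∈ S then E ⟨u, hu⟩ else a
  have hκ : ∀ u (hu : u ∈ S), κ u = E ⟨u, hu⟩ := fun u hu => dif_pos hu
  have hκi : Set.InjOn κ S := by
    intro u hu v hv huv
    rw [hκ u hu, hκ v hv] at huv
    simpa using E.injective (Subtype.ext huv)
  have h1 : ∀ u ∈ coimage f, Sum.inl u ∈ S := fun u hu => Or.inl ⟨u, hu, rfl⟩
  have h2 : ∀ u ∈ coimage g, Sum.inr u ∈ S := fun u hu => Or.inr ⟨u, hu, rfl⟩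
  obtain ⟨p, q, hqp, ⟨s, hs⟩, ⟨t, ht⟩⟩ := exists_weave f.injective g.injective h.injective
    (κ₁ := fun u => κ (Sum.inl u)) (κ₂ := fun u => κ (Sum.inr u))
    (fun u hu v hv huv => Sum.inl_injective (hκi (h1 u hu) (h1 v hv) huv))
    (fun u hu v hv huv => Sum.inr_injective (hκi (h2 u hu) (h2 v hv) huv))
    (by
      ext z
      constructor
      · rintro (⟨u, hu, rfl⟩ | ⟨u, hu, rfl⟩)
        · simp only [hκ _ (h1 u hu)]
          exact (E _).2
        · simp only [hκ _ (h2 u hu)]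
          exact (E _).2
      · intro hz
        have h3 : κ (E.symm ⟨z, hz⟩).1 = z := by
          rw [hκ _ (E.symm ⟨z, hz⟩).2]
          simp
        rcases h4 : E.symm ⟨z, hz⟩ with ⟨_, ⟨u, hu, rfl⟩ | ⟨u, hu, rfl⟩⟩
        · rw [h4] at h3
          exact Or.inl ⟨u, hu, h3⟩
        · rw [h4] at h3
          exact Or.inr ⟨u, hu, h3⟩)
    (by
      rw [Set.disjoint_iff_forall_ne]
      rintro _ ⟨u, hu, rfl⟩ _ ⟨v, hv, rfl⟩ huv
      exact absurd (hκi (h1 u hu) (h2 v hv) huv) (by simp))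
    ha hb
  refine ⟨s.symm, t.symm, ?_⟩
  ext x
  change t (g (t.symm (s (f (s.symm x))))) = h x
  rw [hs, ht, Equiv.apply_symm_apply, Equiv.apply_symm_apply, hqp]

end Product

/-! ### Cycles as orbits, and their cardinalities -/

section Cycles

variable {Ω : Type*}

/-- The cycle under `f` that contains `x`. -/
def cycleOf (f : Ω → Ω) (x : Ω) : Set Ω := {y | ∃ m n, f^[m] y = f^[n] x}

theorem mem_cycleOf_self (f : Ω → Ω) (x : Ω) : x ∈ cycleOf f x := ⟨0, 0, rfl⟩

theorem iterate_mem_cycleOf (f : Ω → Ω) (x : Ω) (n : ℕ) : f^[n] x ∈ cycleOf f x := ⟨0, n, rfl⟩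

theorem IsFullyInvariant.iterate {f : Inj Ω} {S : Set Ω} (hS : IsFullyInvariant f S) (n : ℕ)
    (x : Ω) : f^[n] x ∈ S ↔ x ∈ S := by
  induction n with
  | zero => rfl
  | succ n ih => rw [iterate_succ_apply', hS, ih]

theorem isFullyInvariant_cycleOf (f : Inj Ω) (x : Ω) : IsFullyInvariant f (cycleOf f x) := by
  refine fun y => ⟨fun ⟨m, n, h⟩ => ⟨m + 1, n, h⟩, fun ⟨m, n, h⟩ => ⟨m, n + 1, ?_⟩⟩
  rw [← iterate_succ_apply, iterate_succ_apply', h, iterate_succ_apply']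

theorem IsFullyInvariant.cycleOf_subset {f : Inj Ω} {S : Set Ω} (hS : IsFullyInvariant f S) {x : Ω}
    (hx : x ∈ S) : cycleOf f x ⊆ S := by
  rintro y ⟨m, n, h⟩
  rwa [← hS.iterate m, h, hS.iterate]

theorem mem_cycleOf_comm {f : Ω → Ω} {x y : Ω} : x ∈ cycleOf f y ↔ y ∈ cycleOf f x :=
  ⟨fun ⟨m, n, h⟩ => ⟨n, m, h.symm⟩, fun ⟨m, n, h⟩ => ⟨n, m, h.symm⟩⟩

theorem isCycle_cycleOf (f : Inj Ω) (x : Ω) : IsCycle f (cycleOf f x) := by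
  refine ⟨⟨x, mem_cycleOf_self _ _⟩, isFullyInvariant_cycleOf f x, fun T hT ⟨y, hy⟩ hT' => ?_⟩
  refine hT.2 (hT'.cycleOf_subset ?_)
  exact hT'.cycleOf_subset hy (mem_cycleOf_comm.1 (hT.1 hy))

theorem IsCycle.eq_cycleOf {f : Inj Ω} {S : Set Ω} (hS : IsCycle f S) {x : Ω} (hx : x ∈ S) :
    S = cycleOf f x := by
  by_contra hne
  exact hS.2.2 _ ((hS.2.1.cycleOf_subset hx).ssubset_of_ne (Ne.symm hne)) ⟨x, mem_cycleOf_self _ _⟩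
    (isFullyInvariant_cycleOf f x)

theorem IsCycle.eq_of_mem {f : Inj Ω} {S T : Set Ω} (hS : IsCycle f S) (hT : IsCycle f T) {x : Ω}
    (hxS : x ∈ S) (hxT : x ∈ T) : S = T :=
  (hS.eq_cycleOf hxS).trans (hT.eq_cycleOf hxT).symm

/-- This also covers infinite cycles: there `minimalPeriod` is 0, and congruence modulo 0 is
equality. -/
theorem iterate_eq_iterate_iff {f : Ω → Ω} (hf : Injective f) (x : Ω) (i j : ℕ) :
    f^[i] x = f^[j] x ↔ i ≡ j [MOD minimalPeriod f x] := by
  wlog hij : i ≤ j generalizing i j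
  · rw [eq_comm, this j i (by omega)]
    exact ⟨Nat.ModEq.symm, Nat.ModEq.symm⟩
  obtain ⟨k, rfl⟩ := Nat.exists_eq_add_of_le hij
  rw [iterate_add_apply, (hf.iterate i).eq_iff, eq_comm, Nat.modEq_iff_dvd' (by omega),
    Nat.add_sub_cancel_left, ← isPeriodicPt_iff_minimalPeriod_dvd]
  rfl

theorem cycleOf_eq_image {f : Ω → Ω} (hf : Injective f) {x : Ω} (hx : 0 < minimalPeriod f x) :
    cycleOf f x = (fun k => f^[k] x) '' Set.Iio (minimalPeriod f x) := by
  refine Set.Subset.antisymm ?_ (by rintro _ ⟨k, _, rfl⟩; exact iterate_mem_cycleOf f x k)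
  rintro y ⟨m, n, h⟩
  -- The exponent should be `n - m`. Modulo the period, `-m` equals `m * (minimalPeriod f x - 1)`,
  -- which avoids truncated subtraction.
  refine ⟨(n + m * (minimalPeriod f x - 1)) % minimalPeriod f x, Nat.mod_lt _ hx, ?_⟩
  refine hf.iterate m ?_
  simp only
  rw [h, ← iterate_add_apply, iterate_eq_iterate_iff hf]
  have h1 : m + (n + m * (minimalPeriod f x - 1)) = n + m * minimalPeriod f x := by
    obtain ⟨k, hk⟩ := Nat.exists_eq_add_of_lt hx
    rw [hk]
    simp
    ring
  calc m + (n + m * (minimalPeriod f x - 1)) % minimalPeriod f x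
      ≡ m + (n + m * (minimalPeriod f x - 1)) [MOD minimalPeriod f x] :=
        (Nat.mod_modEq _ _).add_left _
    _ = n + m * minimalPeriod f x := h1
    _ ≡ n [MOD minimalPeriod f x] := by simp [Nat.ModEq]

theorem encard_cycleOf {f : Ω → Ω} (hf : Injective f) {x : Ω} (hx : 0 < minimalPeriod f x) :
    (cycleOf f x).encard = minimalPeriod f x := by
  rw [cycleOf_eq_image hf hx, Set.InjOn.encard_image]
  · simp [Set.encard_coe_eq_coe_finsetCard, ← Finset.coe_range]
  · intro i hi j hj hij
    exact ((iterate_eq_iterate_iff hf x i j).1 hij).eq_of_lt_of_lt hi hj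

theorem infinite_cycleOf {f : Ω → Ω} (hf : Injective f) {x : Ω} (hx : minimalPeriod f x = 0) :
    (cycleOf f x).Infinite := by
  refine Set.infinite_of_injective_forall_mem (f := fun n => f^[n] x) ?_
    (iterate_mem_cycleOf f x)
  intro i j hij
  have := (iterate_eq_iterate_iff hf x i j).1 hij
  rwa [hx, Nat.modEq_zero_iff] at this

theorem minimalPeriod_of_infinite {f : Ω → Ω} (hf : Injective f) {x : Ω}
    (hx : (cycleOf f x).Infinite) : minimalPeriod f x = 0 := by
  by_contra h
  have := encard_cycleOf hf (Nat.pos_of_ne_zero h)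
  rw [hx.encard_eq] at this
  exact ENat.top_ne_natCast _ this

theorem minimalPeriod_of_encard {f : Ω → Ω} (hf : Injective f) {x : Ω} {n : ℕ}
    (hx : (cycleOf f x).encard = n) : minimalPeriod f x = n := by
  rcases Nat.eq_zero_or_pos (minimalPeriod f x) with h | h
  · rw [(infinite_cycleOf hf h).encard_eq] at hx
    exact absurd hx (ENat.top_ne_natCast _)
  · rw [encard_cycleOf hf h] at hx
    exact_mod_cast hx

theorem isForwardCycle_cycleOf (f : Inj Ω) {x : Ω} (hx : x ∈ coimage f) :
    IsForwardCycle f (cycleOf f x) := by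
  refine ⟨isCycle_cycleOf f x, ?_, ⟨x, mem_cycleOf_self _ _, hx⟩⟩
  exact Set.infinite_of_injective_forall_mem (iterate_injective_of_notMem_range f.injective hx)
    (iterate_mem_cycleOf f x)

/-- Each forward cycle contains exactly one point outside the range: two such points with a common
iterate coincide, since cancelling iterates would otherwise put one of them into the range. -/
theorem numFwd_eq (f : Inj Ω) : numFwd f = (coimage f).encard := by
  have h : {S : Set Ω | IsForwardCycle f S} = (fun x => cycleOf f x) '' coimage f := by
    ext S
    constructor
    · rintro ⟨hS, _, x, hx, hx'⟩
      exact ⟨x, hx', (hS.eq_cycleOf hx).symm⟩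
    · rintro ⟨x, hx, rfl⟩
      exact isForwardCycle_cycleOf f hx
  rw [numFwd, h, Set.InjOn.encard_image]
  have key : ∀ x ∈ coimage f, ∀ y, ∀ m k, f^[m] x = f^[m + k] y → x = y := by
    intro x hx y m k h
    rw [iterate_add_apply] at h
    have h := f.injective.iterate m h
    cases k with
    | zero => exact h
    | succ k =>
      rw [iterate_succ_apply'] at h
      exact absurd ⟨_, h.symm⟩ hx
  intro x hx y hy hxy
  have hxy : cycleOf f x = cycleOf f y := hxy
  obtain ⟨m, n, h⟩ : x ∈ cycleOf f y := hxy ▸ mem_cycleOf_self f x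
  rcases Nat.le_total m n with hmn | hmn
  · obtain ⟨k, rfl⟩ := Nat.exists_eq_add_of_le hmn
    exact key x hx y m k h
  · obtain ⟨k, rfl⟩ := Nat.exists_eq_add_of_le hmn
    exact (key y hy x n k h.symm).symm

theorem exists_infinite_cycle {f : Inj Ω} (h : 1 ≤ numOpen f + numFwd f) :
    ∃ S, IsCycle f S ∧ S.Infinite := by
  by_contra hne
  push Not at hne
  have h1 : numOpen f = 0 := by
    rw [numOpen, Set.encard_eq_zero, Set.eq_empty_iff_forall_notMem]
    rintro S ⟨h1, h2, _⟩
    exact h2 (hne S h1)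
  have h2 : numFwd f = 0 := by
    rw [numFwd, Set.encard_eq_zero, Set.eq_empty_iff_forall_notMem]
    rintro S ⟨h1, h2, _⟩
    exact h2 (hne S h1)
  rw [h1, h2] at h
  simp at h

theorem exists_infinite_cycles {f : Inj Ω} (h : 2 ≤ numOpen f + numFwd f) :
    ∃ S T, IsCycle f S ∧ S.Infinite ∧ IsCycle f T ∧ T.Infinite ∧ S ≠ T := by
  rw [numOpen, numFwd, ← Set.encard_union_eq] at h
  · have h' : 1 < ({S : Set Ω | IsOpenCycle f S} ∪ {S | IsForwardCycle f S}).encard :=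
      lt_of_lt_of_le (by norm_num) h
    obtain ⟨S, T, hS, hT, hST⟩ := Set.one_lt_encard_iff.1 h'
    have key : ∀ S ∈ ({S : Set Ω | IsOpenCycle f S} ∪ {S | IsForwardCycle f S}),
        IsCycle f S ∧ S.Infinite := by
      rintro S (hS | hS)
      exacts [⟨hS.1, hS.2.1⟩, ⟨hS.1, hS.2.1⟩]
    exact ⟨S, T, (key S hS).1, (key S hS).2, (key T hT).1, (key T hT).2, hST⟩
  · rw [Set.disjoint_left]
    exact fun S h1 h2 => h1.2.2 h2

/-! ### Cycle counts determine a map up to conjugacy -/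

section Classification

/-- With one base point `x i` per cycle, a point is located by a pair `(m, k)` with `f^[m] z = f^[k]
(x i)`, and `Φ` keeps the coordinates. `hper` makes this well defined, and `hrange` provides targets
for points that lie before the base point. The description is symmetric, so swapping the roles
yields the inverse. -/
theorem exists_matching {f g : Ω → Ω} (hf : Injective f) (hg : Injective g) {I : Type*}
    {x y : I → Ω} (hx : ∀ z, ∃ i, z ∈ cycleOf f (x i))
    (hx' : ∀ i j z, z ∈ cycleOf f (x i) → z ∈ cycleOf f (x j) → i = j)
    (hper : ∀ i a b, f^[a] (x i) = f^[b] (x i) ↔ g^[a] (y i) = g^[b] (y i))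
    (hrange : ∀ i a, x i ∈ Set.range f^[a] → y i ∈ Set.range g^[a]) :
    ∃ Φ : Ω → Ω, ∀ z w, Φ z = w ↔ ∃ i m k, f^[m] z = f^[k] (x i) ∧ g^[m] w = g^[k] (y i) := by
  have tot : ∀ z, ∃ w i m k, f^[m] z = f^[k] (x i) ∧ g^[m] w = g^[k] (y i) := by
    intro z
    obtain ⟨i, m, k, h⟩ := hx z
    rcases Nat.le_total m k with hmk | hmk
    · obtain ⟨k, rfl⟩ := Nat.exists_eq_add_of_le hmk
      exact ⟨g^[k] (y i), i, m, m + k, h, (iterate_add_apply _ _ _ _).symm⟩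
    · obtain ⟨m, rfl⟩ := Nat.exists_eq_add_of_le hmk
      obtain ⟨w, hw⟩ := hrange i m
        ⟨z, hf.iterate k (by rw [← iterate_add_apply, h])⟩
      exact ⟨w, i, k + m, k, h, by rw [iterate_add_apply, hw]⟩
  choose Φ hΦ using tot
  refine ⟨Φ, fun z w => ⟨?_, ?_⟩⟩
  · rintro rfl
    exact hΦ z
  · rintro ⟨i, m, k, h1, h2⟩
    obtain ⟨j, m', k', h3, h4⟩ := hΦ z
    obtain rfl := hx' i j z ⟨m, k, h1⟩ ⟨m', k', h3⟩
    have h5 : f^[m' + k] (x i) = f^[m + k'] (x i) := by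
      rw [iterate_add_apply, ← h1, iterate_add_apply, ← h3, ← iterate_add_apply,
        ← iterate_add_apply, add_comm]
    have h6 := (hper i _ _).1 h5
    rw [iterate_add_apply, ← h2, iterate_add_apply, ← h4, ← iterate_add_apply,
        ← iterate_add_apply, add_comm] at h6
    exact (hg.iterate _ h6).symm

theorem exists_perm_of_bases {f g : Ω → Ω} (hf : Injective f) (hg : Injective g) {I : Type*}
    {x y : I → Ω} (hx : ∀ z, ∃ i, z ∈ cycleOf f (x i))
    (hx' : ∀ i j z, z ∈ cycleOf f (x i) → z ∈ cycleOf f (x j) → i = j)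
    (hy : ∀ z, ∃ i, z ∈ cycleOf g (y i))
    (hy' : ∀ i j z, z ∈ cycleOf g (y i) → z ∈ cycleOf g (y j) → i = j)
    (hper : ∀ i a b, f^[a] (x i) = f^[b] (x i) ↔ g^[a] (y i) = g^[b] (y i))
    (hrange : ∀ i a, x i ∈ Set.range f^[a] ↔ y i ∈ Set.range g^[a]) :
    ∃ s : Equiv.Perm Ω, ∀ z, s (f z) = g (s z) := by
  obtain ⟨Φ, hΦ⟩ := exists_matching hf hg hx hx' hper fun i a => (hrange i a).1
  obtain ⟨Ψ, hΨ⟩ := exists_matching hg hf hy hy' (fun i a b => (hper i a b).symm)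
    fun i a => (hrange i a).2
  refine ⟨⟨Φ, Ψ, fun z => ?_, fun z => ?_⟩, fun z => ?_⟩
  · obtain ⟨i, m, k, h1, h2⟩ := (hΦ z _).1 rfl
    exact (hΨ _ _).2 ⟨i, m, k, h2, h1⟩
  · obtain ⟨i, m, k, h1, h2⟩ := (hΨ z _).1 rfl
    exact (hΦ _ _).2 ⟨i, m, k, h2, h1⟩
  · obtain ⟨i, m, k, h1, h2⟩ := (hΦ z _).1 rfl
    refine (hΦ _ _).2 ⟨i, m, k + 1, ?_, ?_⟩
    · rw [← iterate_succ_apply, iterate_succ_apply', h1, iterate_succ_apply']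
    · change g^[m] (g (Φ z)) = _
      rw [← iterate_succ_apply, iterate_succ_apply', h2, iterate_succ_apply']

/-- The cycles under `f` of a given type: those of cardinality `n`, the open and the forward ones. -/
def cyclesOfType (f : Inj Ω) : Option (Option ℕ+) → Set (Set Ω)
  | some (some n) => {S | IsCycle f S ∧ S.encard = (n : ℕ)}
  | some none => {S | IsOpenCycle f S}
  | none => {S | IsForwardCycle f S}

theorem isCycle_of_mem_cyclesOfType {f : Inj Ω} {τ : Option (Option ℕ+)} {S : Set Ω}
    (h : S ∈ cyclesOfType f τ) : IsCycle f S := by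
  rcases τ with _ | _ | n <;> exact h.1

theorem exists_mem_cyclesOfType {f : Inj Ω} {S : Set Ω} (hS : IsCycle f S) :
    ∃ τ, S ∈ cyclesOfType f τ := by
  by_cases hf : S.Finite
  · have h : S.ncard ≠ 0 := by
      rw [Ne, Set.ncard_eq_zero hf]
      exact hS.1.ne_empty
    exact ⟨some (some ⟨S.ncard, Nat.pos_of_ne_zero h⟩), hS, hf.cast_ncard_eq.symm⟩
  · by_cases h : IsForwardCycle f S
    · exact ⟨none, h⟩
    · exact ⟨some none, hS, hf, h⟩

theorem cyclesOfType_unique {f : Inj Ω} {S : Set Ω} {τ τ' : Option (Option ℕ+)}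
    (h : S ∈ cyclesOfType f τ) (h' : S ∈ cyclesOfType f τ') : τ = τ' := by
  have key : ∀ n : ℕ, S.Infinite → S.encard ≠ n := fun n hS => by
    rw [hS.encard_eq]; exact ENat.top_ne_natCast _
  rcases τ with _ | _ | n <;> rcases τ' with _ | _ | n'
  · rfl
  · exact absurd h h'.2.2
  · exact absurd h'.2 (key _ h.2.1)
  · exact absurd h' h.2.2
  · rfl
  · exact absurd h'.2 (key _ h.2.1)
  · exact absurd h.2 (key _ h'.2.1)
  · exact absurd h.2 (key _ h'.2.1)
  · have := h.2.symm.trans h'.2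
    rw [PNat.coe_inj.1 (by exact_mod_cast this : (n : ℕ) = n')]

/-- The base point of a forward cycle is its initial point; any point serves for the other types.
Its period and its backward extendability then depend on the type alone, as `exists_perm_of_bases`
needs. -/
theorem exists_base {f : Inj Ω} {τ : Option (Option ℕ+)} {S : Set Ω} (h : S ∈ cyclesOfType f τ) :
    ∃ x ∈ S, minimalPeriod f x = (τ.bind id).elim 0 PNat.val ∧
      ∀ a, x ∈ Set.range f^[a] ↔ (τ = none → a = 0) := by
  rcases τ with _ | _ | n
  · obtain ⟨h1, h2, x, hx, hx'⟩ := h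
    refine ⟨x, hx, ?_, fun a => ?_⟩
    · rw [h1.eq_cycleOf hx] at h2
      exact minimalPeriod_of_infinite f.injective h2
    · cases a with
      | zero => simp
      | succ a =>
        simp only [Nat.add_eq_zero_iff, one_ne_zero, and_false, imp_false, not_true_eq_false,
          iff_false]
        rintro ⟨y, hy⟩
        rw [iterate_succ_apply'] at hy
        exact hx' ⟨_, hy⟩
  · obtain ⟨h1, h2, h3⟩ := h
    obtain ⟨x, hx⟩ := h1.1
    have hS : ∀ z ∈ S, z ∈ Set.range f := fun z hz => by
      by_contra hz'
      exact h3 ⟨h1, h2, z, hz, hz'⟩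
    refine ⟨x, hx, ?_, fun a => ?_⟩
    · rw [h1.eq_cycleOf hx] at h2
      exact minimalPeriod_of_infinite f.injective h2
    · simp only [reduceCtorEq, false_imp_iff, iff_true]
      induction a with
      | zero => simp
      | succ a ih =>
        obtain ⟨y, rfl⟩ := ih
        obtain ⟨z, rfl⟩ := hS y ((h1.2.1.iterate _ _).1 hx)
        exact ⟨z, rfl⟩
  · obtain ⟨h1, h2⟩ := h
    obtain ⟨x, hx⟩ := h1.1
    rw [h1.eq_cycleOf hx] at h2
    have h3 := minimalPeriod_of_encard f.injective h2
    refine ⟨x, hx, h3, fun a => ?_⟩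
    simp only [reduceCtorEq, false_imp_iff, iff_true]
    -- Another `a` steps make `a * n` in total, a multiple of the period.
    refine ⟨f^[a * n - a] x, ?_⟩
    rw [← iterate_add_apply, ← Nat.add_sub_assoc (Nat.le_mul_of_pos_right a n.pos),
      Nat.add_sub_cancel_left]
    refine (iterate_eq_iterate_iff f.injective x _ 0).2 ?_
    rw [h3]
    simp [Nat.ModEq]

theorem exists_perm_of_counts [Countable Ω] {f g : Inj Ω} (h1 : numOpen f = numOpen g)
    (h2 : numFwd f = numFwd g) (h3 : ∀ n, numCycles f n = numCycles g n) :
    ∃ s : Equiv.Perm Ω, ∀ z, s (f z) = g (s z) := by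
  have hcount : ∀ (f : Inj Ω) τ, (cyclesOfType f τ).Countable := by
    intro f τ
    refine (Set.countable_range (fun x => cycleOf f x)).mono fun S hS => ?_
    have hS := isCycle_of_mem_cyclesOfType hS
    obtain ⟨x, hx⟩ := hS.1
    exact ⟨x, (hS.eq_cycleOf hx).symm⟩
  have hE : ∀ τ, Nonempty (cyclesOfType f τ ≃ cyclesOfType g τ) := by
    intro τ
    refine nonempty_equiv_of_encard_eq (hcount f τ) (hcount g τ) ?_
    rcases τ with _ | _ | n
    exacts [h2, h1, h3 n]
  let E := fun τ => (hE τ).some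
  choose x hxS hxp hxr using fun i : Σ τ, cyclesOfType f τ => exists_base i.2.2
  choose y hyS hyp hyr using fun i : Σ τ, cyclesOfType g τ => exists_base i.2.2
  have cover : ∀ (f : Inj Ω) (x : (Σ τ, cyclesOfType f τ) → Ω), (∀ i, x i ∈ i.2.1) →
      ∀ z, ∃ i, z ∈ cycleOf f (x i) := by
    intro f x hx z
    obtain ⟨τ, hτ⟩ := exists_mem_cyclesOfType (isCycle_cycleOf f z)
    exact ⟨⟨τ, _, hτ⟩, mem_cycleOf_comm.1 (hx ⟨τ, _, hτ⟩)⟩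
  have sep : ∀ (f : Inj Ω) (x : (Σ τ, cyclesOfType f τ) → Ω), (∀ i, x i ∈ i.2.1) →
      ∀ i j z, z ∈ cycleOf f (x i) → z ∈ cycleOf f (x j) → i = j := by
    rintro f x hx ⟨τ, S, hS⟩ ⟨τ', S', hS'⟩ z hz hz'
    rw [← (isCycle_of_mem_cyclesOfType hS).eq_cycleOf (hx ⟨τ, S, hS⟩)] at hz
    rw [← (isCycle_of_mem_cyclesOfType hS').eq_cycleOf (hx ⟨τ', S', hS'⟩)] at hz'
    obtain rfl := (isCycle_of_mem_cyclesOfType hS).eq_of_mem (isCycle_of_mem_cyclesOfType hS') hz hz'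
    obtain rfl := cyclesOfType_unique hS hS'
    rfl
  let e : (Σ τ, cyclesOfType f τ) ≃ Σ τ, cyclesOfType g τ := Equiv.sigmaCongrRight E
  refine exists_perm_of_bases f.injective g.injective (x := x) (y := fun i => y (e i))
    (cover f x hxS) (sep f x hxS) (fun z => ?_)
    (fun i j z hi hj => e.injective (sep g y hyS _ _ z hi hj)) (fun i a b => ?_) (fun i a => ?_)
  · obtain ⟨i, hi⟩ := cover g y hyS z
    exact ⟨e.symm i, by rwa [Equiv.apply_symm_apply]⟩
  · rw [iterate_eq_iterate_iff f.injective, iterate_eq_iterate_iff g.injective, hxp, hyp]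
    rfl
  · rw [hxr, hyr]
    rfl

end Classification

end Cycles

/-! ### The effect of one transposition on the cycles -/

section Split

variable {Ω : Type*}

theorem IsCycle.eq_of_iterate_eq {f : Inj Ω} {S : Set Ω} (hS : IsCycle f S)
    (hinf : S.Infinite) {x : Ω} (hx : x ∈ S) {i j : ℕ} (h : f^[i] x = f^[j] x) : i = j := by
  rw [hS.eq_cycleOf hx] at hinf
  rwa [iterate_eq_iterate_iff f.injective, minimalPeriod_of_infinite f.injective hinf,
    Nat.modEq_zero_iff] at h

/-- The effect on cycles of cutting the cycle `C = {x, (x)f, …}` of cardinality `n` out of an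
infinite cycle `S` under `f`. -/
structure IsSplitting (f f' : Inj Ω) (S C : Set Ω) (n : ℕ) : Prop where
  isCycle : IsCycle f S
  infinite : S.Infinite
  subset : C ⊆ S
  encard_eq : C.encard = n
  isCycle_iff : ∀ T, IsCycle f' T ↔ T = C ∨ T = S \ C ∨ (IsCycle f T ∧ T ≠ S)
  forward_sdiff : ((S \ C) \ Set.range f').Nonempty ↔ (S \ Set.range f).Nonempty
  forward_of_ne : ∀ T, IsCycle f T → T ≠ S → T \ Set.range f' = T \ Set.range f

-- Take the transposition of `x` and `y = f^[n] x`. The arrow into `y` is redirected to `x`, which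
-- closes the segment from `x` to its last point before `y`. An arrow into `x`, if any, is
-- redirected to `y`, so the rest of `S` remains one infinite cycle.
open Classical in
theorem exists_isSplitting {f : Inj Ω} {S : Set Ω} (hS : IsCycle f S) (hinf : S.Infinite) {n : ℕ}
    (hn : 0 < n) :
    ∃ t : Equiv.Perm Ω, t.IsSwap ∧ ∃ C, IsSplitting f (f * (t.toEmbedding : Inj Ω)) S C n := by
  obtain ⟨x, hx⟩ := hS.1
  have hap : ∀ i j, f^[i] x = f^[j] x → i = j := fun i j =>
    IsCycle.eq_of_iterate_eq hS hinf hx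
  obtain ⟨y, hy⟩ : ∃ y, f^[n] x = y := ⟨_, rfl⟩
  have hyS : y ∈ S := by rwa [← hy, hS.2.1.iterate]
  have hxy : x ≠ y := fun h => hn.ne (hap 0 n (h.trans hy.symm))
  let C : Set Ω := (fun k => f^[k] x) '' Set.Iio n
  have hxC : x ∈ C := ⟨0, hn, rfl⟩
  have hyC : y ∉ C := by
    rintro ⟨k, hk, hk'⟩
    exact (ne_of_lt hk) (hap k n (hk'.trans hy.symm))
  have hCS : C ⊆ S := by
    rintro _ ⟨k, _, rfl⟩
    exact (hS.2.1.iterate k x).2 hx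
  let f' : Inj Ω := f * ((Equiv.swap x y).toEmbedding : Inj Ω)
  have hf' : ∀ z, f' z = Equiv.swap x y (f z) := fun z => rfl
  have hf'1 : ∀ z, f z ≠ x → f z ≠ y → f' z = f z := fun z h1 h2 =>
    (hf' z).trans (Equiv.swap_apply_of_ne_of_ne h1 h2)
  have hf'x : ∀ z, f z = x → f' z = y := fun z h => by rw [hf', h, Equiv.swap_apply_left]
  have hf'y : ∀ z, f z = y → f' z = x := fun z h => by rw [hf', h, Equiv.swap_apply_right]
  have hfx : ∀ z, f z = x → z ∉ C := by
    rintro _ h ⟨k, _, rfl⟩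
    simp only at h
    rw [← iterate_succ_apply' f] at h
    have := hap (k + 1) 0 h
    omega
  have hfy : ∀ z, f z = y → z ∈ C := by
    intro z hz
    obtain ⟨m, rfl⟩ : ∃ m, n = m + 1 := ⟨n - 1, by omega⟩
    refine ⟨m, Nat.lt_succ_self m, f.injective ?_⟩
    rw [hz, ← hy, iterate_succ_apply']
  have hfC : ∀ z, f z ≠ x → f z ≠ y → (f z ∈ C ↔ z ∈ C) := by
    intro z h1 h2
    constructor
    · rintro ⟨k, hk, hk'⟩
      cases k with
      | zero => exact absurd hk'.symm h1
      | succ k =>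
        simp only at hk'
        rw [iterate_succ_apply'] at hk'
        exact ⟨k, Nat.lt_of_succ_lt hk, f.injective hk'⟩
    · rintro ⟨k, hk, rfl⟩
      refine ⟨k + 1, Set.mem_Iio.2 (lt_of_le_of_ne (Nat.succ_le_of_lt hk) ?_), iterate_succ_apply' f k x⟩
      rintro rfl
      exact h2 (by rw [← hy, iterate_succ_apply'])
  have hCinv : IsFullyInvariant f' C := by
    intro z
    by_cases h1 : f z = x
    · rw [hf'x z h1]
      exact iff_of_false hyC (hfx z h1)
    by_cases h2 : f z = y
    · rw [hf'y z h2]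
      exact iff_of_true hxC (hfy z h2)
    rw [hf'1 z h1 h2, hfC z h1 h2]
  have hSinv : IsFullyInvariant f' S := by
    intro z
    by_cases h1 : f z = x
    · rw [hf'x z h1]
      exact iff_of_true hyS ((hS.2.1 z).1 (h1 ▸ hx))
    by_cases h2 : f z = y
    · rw [hf'y z h2]
      exact iff_of_true hx ((hS.2.1 z).1 (h2 ▸ hyS))
    rw [hf'1 z h1 h2, hS.2.1 z]
  have hCcyc : IsCycle f' C := by
    refine ⟨⟨x, hxC⟩, hCinv, fun T hT hTne hTinv => ?_⟩
    have key : ∀ k < n, f^[k] x ∈ T ↔ x ∈ T := by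
      intro k
      induction k with
      | zero => intro _; rfl
      | succ k ih =>
        intro hk
        rw [← ih (by omega), iterate_succ_apply', ← hTinv (f^[k] x), hf'1]
        · intro h
          rw [← iterate_succ_apply' f] at h
          have := hap (k + 1) 0 h
          omega
        · intro h
          rw [← iterate_succ_apply' f, ← hy] at h
          have := hap (k + 1) n h
          omega
    obtain ⟨z, hz⟩ := hTne
    obtain ⟨k, hk, rfl⟩ := hT.1 hz
    refine hT.2 ?_
    rintro _ ⟨l, hl, rfl⟩
    exact (key l hl).2 ((key k hk).1 hz)
  have hDcyc : IsCycle f' (S \ C) := by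
    refine ⟨⟨y, hyS, hyC⟩, fun z => ?_, fun T hT hTne hTinv => ?_⟩
    · exact and_congr (hSinv z) (not_congr (hCinv z))
    · have hxT : x ∉ T := fun h => (hT.1 h).2 hxC
      -- Only the arrows into `x` and `y` differ from those of `f`. So if `y ∈ T` then `T ∪ C` is
      -- invariant under `f`, hence contains `S`; otherwise `T` itself is, which forces `x ∈ T`.
      by_cases hyT : y ∈ T
      · have hinv : IsFullyInvariant f (T ∪ C) := by
          intro z
          by_cases h1 : f z = x
          · rw [h1]
            refine iff_of_true (Or.inr hxC) (Or.inl ?_)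
            rwa [← hTinv, hf'x z h1]
          by_cases h2 : f z = y
          · rw [h2]
            exact iff_of_true (Or.inl hyT) (Or.inr (hfy z h2))
          rw [← hf'1 z h1 h2]
          exact or_congr (hTinv z) (hCinv z)
        have h3 := hinv.cycleOf_subset (Or.inr hxC)
        rw [← hS.eq_cycleOf hx] at h3
        exact hT.2 fun z hz => (h3 hz.1).resolve_right hz.2
      · have hinv : IsFullyInvariant f T := by
          intro z
          by_cases h1 : f z = x
          · rw [h1]
            refine iff_of_false hxT fun h => hyT ?_
            rwa [← hTinv, hf'x z h1] at h
          by_cases h2 : f z = y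
          · rw [h2]
            refine iff_of_false hyT fun h => hxT ?_
            rwa [← hTinv, hf'y z h2] at h
          rw [← hf'1 z h1 h2, hTinv]
        obtain ⟨z, hz⟩ := hTne
        have h3 := hinv.cycleOf_subset hz
        rw [← hS.eq_cycleOf (hT.1 hz).1] at h3
        exact hxT (h3 hx)
  have hTcyc : ∀ T, IsCycle f T → T ≠ S → IsCycle f' T := by
    intro T hT hTS
    have hd : ∀ z ∈ T, z ∉ S := fun z hz hz' => hTS (hT.eq_of_mem hS hz hz')
    have hinv : ∀ U ⊆ T, (IsFullyInvariant f' U ↔ IsFullyInvariant f U) := by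
      intro U hU
      refine forall_congr' fun z => ?_
      have hxU : x ∉ U := fun h => hd x (hU h) hx
      have hyU : y ∉ U := fun h => hd y (hU h) hyS
      by_cases h1 : f z = x
      · rw [hf'x z h1, h1]
        simp [hxU, hyU]
      by_cases h2 : f z = y
      · rw [hf'y z h2, h2]
        simp [hxU, hyU]
      rw [hf'1 z h1 h2]
    exact ⟨hT.1, (hinv T subset_rfl).2 hT.2.1, fun U hU hUne hUinv =>
      hT.2.2 U hU hUne ((hinv U hU.1).1 hUinv)⟩
  have hrange : ∀ z, z ∉ Set.range f' ↔ Equiv.swap x y z ∉ Set.range f := by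
    intro z
    refine not_congr ⟨?_, ?_⟩
    · rintro ⟨w, rfl⟩
      exact ⟨w, by rw [hf', Equiv.swap_apply_self]⟩
    · rintro ⟨w, hw⟩
      exact ⟨w, by rw [hf', hw, Equiv.swap_apply_self]⟩
  have hyr : y ∈ Set.range f := by
    obtain ⟨m, rfl⟩ : ∃ m, n = m + 1 := ⟨n - 1, by omega⟩
    exact ⟨_, by rw [← hy, iterate_succ_apply']⟩
  refine ⟨Equiv.swap x y, ⟨x, y, hxy, rfl⟩, C, hS, hinf, hCS, ?_, fun T => ⟨fun hT => ?_, ?_⟩, ?_, ?_⟩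
  · rw [Set.InjOn.encard_image]
    · simp [Set.encard_coe_eq_coe_finsetCard, ← Finset.coe_range]
    · intro i _ j _ hij
      exact hap i j hij
  · obtain ⟨z, hz⟩ := hT.1
    by_cases hzS : z ∈ S
    · by_cases hzC : z ∈ C
      · exact Or.inl (hT.eq_of_mem hCcyc hz hzC)
      · exact Or.inr (Or.inl (hT.eq_of_mem hDcyc hz ⟨hzS, hzC⟩))
    · have h1 : cycleOf f z ≠ S := fun h => hzS (h ▸ mem_cycleOf_self _ _)
      have h2 := hT.eq_of_mem (hTcyc _ (isCycle_cycleOf f z) h1) hz (mem_cycleOf_self _ _)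
      rw [h2]
      exact Or.inr (Or.inr ⟨isCycle_cycleOf f z, h1⟩)
  · rintro (rfl | rfl | ⟨h1, h2⟩)
    exacts [hCcyc, hDcyc, hTcyc T h1 h2]
  · constructor
    · rintro ⟨z, ⟨hzS, hzC⟩, hz⟩
      rw [hrange] at hz
      refine ⟨_, ?_, hz⟩
      rw [Equiv.swap_apply_def]
      split_ifs
      exacts [hyS, hx, hzS]
    · rintro ⟨z, hzS, hz⟩
      -- If `S` starts at `x`, the remaining cycle starts at `y`; otherwise the starting point is
      -- unchanged.
      by_cases hzx : z = x
      · refine ⟨y, ⟨hyS, hyC⟩, ?_⟩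
        rw [hrange, Equiv.swap_apply_right, ← hzx]
        exact hz
      · refine ⟨z, ⟨hzS, ?_⟩, ?_⟩
        · rintro ⟨k, _, rfl⟩
          cases k with
          | zero => exact hzx rfl
          | succ k => exact hz ⟨_, (iterate_succ_apply' f k x).symm⟩
        · rw [hrange, Equiv.swap_apply_of_ne_of_ne hzx]
          · exact hz
          · rintro rfl
            exact hz hyr
  · intro T hT hTS
    ext z
    refine and_congr_right fun hz => ?_
    have hzS : z ∉ S := fun hz' => hTS (hT.eq_of_mem hS hz hz')
    rw [hrange, Equiv.swap_apply_of_ne_of_ne]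
    · rintro rfl; exact hzS hx
    · rintro rfl; exact hzS hyS

namespace IsSplitting

variable {f f' : Inj Ω} {S C : Set Ω} {n : ℕ}

theorem finite (h : IsSplitting f f' S C n) : C.Finite :=
  Set.finite_of_encard_eq_coe h.encard_eq

theorem infinite_sdiff (h : IsSplitting f f' S C n) : (S \ C).Infinite := h.infinite.sdiff h.finite

theorem ne_sdiff (h : IsSplitting f f' S C n) {T : Set Ω} (hT : IsCycle f T) (hTS : T ≠ S) :
    T ≠ S \ C := by
  rintro rfl
  obtain ⟨z, hz⟩ := hT.1
  exact hTS (hT.eq_of_mem h.isCycle hz hz.1)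

/-- Replacing `S` by `S \ C` and fixing all other cycles is a bijection on infinite cycles. It
serves for forward and open cycles alike. -/
theorem encard_eq_of_iff (h : IsSplitting f f' S C n) {p p' : Set Ω → Prop}
    (hp : ∀ T, p T → IsCycle f T)
    (hp' : ∀ T, p' T → IsCycle f' T ∧ T.Infinite) (hS : p' (S \ C) ↔ p S)
    (hT : ∀ T, IsCycle f T → T ≠ S → (p' T ↔ p T)) :
    {T | p' T}.encard = {T | p T}.encard := by
  classical
  have himage : {T | p' T} = (fun T => if T = S then S \ C else T) '' {T | p T} := by
    ext T
    constructor
    · intro hT'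
      have hT' : p' T := hT'
      obtain ⟨h1, h2⟩ := hp' T hT'
      rcases (h.isCycle_iff T).1 h1 with rfl | rfl | ⟨h3, h4⟩
      · exact absurd h.finite h2
      · exact ⟨S, hS.1 hT', if_pos rfl⟩
      · exact ⟨T, (hT T h3 h4).1 hT', if_neg h4⟩
    · rintro ⟨U, hU, rfl⟩
      have hU : p U := hU
      by_cases hUS : U = S
      · subst hUS
        simp only [if_true]
        exact hS.2 hU
      · simp only [if_neg hUS]
        exact (hT U (hp U hU) hUS).2 hU
  rw [himage, Set.InjOn.encard_image]
  intro T h1 U h2 hTU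
  have h1 := hp T h1
  have h2 := hp U h2
  simp only at hTU
  split_ifs at hTU with h3 h4 h4
  · rw [h3, h4]
  · exact absurd hTU.symm (h.ne_sdiff h2 h4)
  · exact absurd hTU (h.ne_sdiff h1 h3)
  · exact hTU

theorem isForwardCycle_sdiff (h : IsSplitting f f' S C n) :
    IsForwardCycle f' (S \ C) ↔ IsForwardCycle f S := by
  rw [IsForwardCycle, IsForwardCycle, h.forward_sdiff]
  simp [h.isCycle_iff, h.infinite_sdiff, h.isCycle, h.infinite]

theorem isForwardCycle_iff (h : IsSplitting f f' S C n) {T : Set Ω} (hT : IsCycle f T)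
    (hTS : T ≠ S) : IsForwardCycle f' T ↔ IsForwardCycle f T := by
  rw [IsForwardCycle, IsForwardCycle, h.forward_of_ne T hT hTS]
  simp [h.isCycle_iff, hT, hTS]

theorem numFwd_eq (h : IsSplitting f f' S C n) : numFwd f' = numFwd f :=
  h.encard_eq_of_iff (fun _ hT => hT.1) (fun _ hT => ⟨hT.1, hT.2.1⟩) h.isForwardCycle_sdiff
    fun _ => h.isForwardCycle_iff

theorem numOpen_eq (h : IsSplitting f f' S C n) : numOpen f' = numOpen f := by
  refine h.encard_eq_of_iff (fun _ hT => hT.1) (fun _ hT => ⟨hT.1, hT.2.1⟩) ?_ fun T hT hTS => ?_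
  · rw [IsOpenCycle, IsOpenCycle, h.isForwardCycle_sdiff]
    simp [h.isCycle_iff, h.infinite_sdiff, h.isCycle, h.infinite]
  · rw [IsOpenCycle, IsOpenCycle, h.isForwardCycle_iff hT hTS]
    simp [h.isCycle_iff, hT, hTS]

theorem numCycles_of_ne (h : IsSplitting f f' S C n) {m : ℕ+} (hm : (m : ℕ) ≠ n) :
    numCycles f' m = numCycles f m := by
  unfold numCycles
  congr 1
  ext T
  refine and_congr_left fun hT => ?_
  have hfin : T.Finite := Set.finite_of_encard_eq_coe hT
  rw [h.isCycle_iff]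
  constructor
  · rintro (rfl | rfl | h1)
    · rw [h.encard_eq] at hT
      exact absurd (by exact_mod_cast hT.symm) hm
    · exact absurd hfin h.infinite_sdiff
    · exact h1.1
  · intro h1
    refine Or.inr (Or.inr ⟨h1, ?_⟩)
    rintro rfl
    exact h.infinite hfin

theorem numCycles_self {n : ℕ+} (h : IsSplitting f f' S C n) :
    numCycles f' n = numCycles f n + 1 := by
  have hC : C ∉ {T : Set Ω | IsCycle f T ∧ T.encard = (n : ℕ)} := by
    rintro ⟨h1, _⟩
    obtain ⟨z, hz⟩ := h1.1
    have := h1.eq_of_mem h.isCycle hz (h.subset hz)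
    exact h.infinite (this ▸ h.finite)
  rw [numCycles, numCycles, ← Set.encard_insert_of_notMem hC]
  congr 1
  ext T
  constructor
  · rintro ⟨h1, h2⟩
    rcases (h.isCycle_iff T).1 h1 with rfl | rfl | h3
    · exact Or.inl rfl
    · exact absurd (Set.finite_of_encard_eq_coe h2) h.infinite_sdiff
    · exact Or.inr ⟨h3.1, h2⟩
  · rintro (rfl | ⟨h1, h2⟩)
    · exact ⟨(h.isCycle_iff T).2 (Or.inl rfl), h.encard_eq⟩
    · refine ⟨(h.isCycle_iff T).2 (Or.inr (Or.inr ⟨h1, ?_⟩)), h2⟩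
      rintro rfl
      exact h.infinite (Set.finite_of_encard_eq_coe h2)

end IsSplitting

open Classical in
/-- Exchanging the ends of two infinite cycles by a transposition gives a conjugate. -/
theorem exists_swap_conj {f : Inj Ω} {S T : Set Ω} (hS : IsCycle f S) (hSinf : S.Infinite)
    (hT : IsCycle f T) (hTinf : T.Infinite) (hST : S ≠ T) :
    ∃ t : Equiv.Perm Ω, t.IsSwap ∧ ∃ s : Equiv.Perm Ω, ∀ z, s (f z) = t (f (s z)) := by
  obtain ⟨x, hx⟩ := hS.1
  obtain ⟨y, hy⟩ := hT.1
  have hxa : ∀ {i j}, f^[i] x = f^[j] x → i = j := IsCycle.eq_of_iterate_eq hS hSinf hx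
  have hya : ∀ {i j}, f^[i] y = f^[j] y → i = j := IsCycle.eq_of_iterate_eq hT hTinf hy
  have hxy : ∀ i j, f^[i] x ≠ f^[j] y := fun i j h =>
    hST (hS.eq_of_mem hT ((hS.2.1.iterate i x).2 hx) (h ▸ (hT.2.1.iterate j y).2 hy))
  -- The conjugating involution exchanges the tails from `x` and from `y`. It commutes with `f`
  -- except at arrows that enter the tails, and there the transposition makes the correction.
  let σ : Ω → Ω := fun z => if h : ∃ k, f^[k] x = z then f^[h.choose] y else
    if h : ∃ k, f^[k] y = z then f^[h.choose] x else z
  have h1 : ∀ k, σ (f^[k] x) = f^[k] y := by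
    intro k
    have h : ∃ l, f^[l] x = f^[k] x := ⟨k, rfl⟩
    simp only [σ, dif_pos h, hxa h.choose_spec]
  have h2 : ∀ k, σ (f^[k] y) = f^[k] x := by
    intro k
    have h0 : ¬ ∃ l, f^[l] x = f^[k] y := fun ⟨l, hl⟩ => hxy l k hl
    have h : ∃ l, f^[l] y = f^[k] y := ⟨k, rfl⟩
    simp only [σ, dif_neg h0, dif_pos h, hya h.choose_spec]
  have h3 : ∀ z, (¬ ∃ k, f^[k] x = z) → (¬ ∃ k, f^[k] y = z) → σ z = z := by
    intro z hz hz'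
    simp only [σ, dif_neg hz, dif_neg hz']
  have hinv : Involutive σ := by
    intro z
    by_cases hz : ∃ k, f^[k] x = z
    · obtain ⟨k, rfl⟩ := hz
      rw [h1, h2]
    by_cases hz' : ∃ k, f^[k] y = z
    · obtain ⟨k, rfl⟩ := hz'
      rw [h2, h1]
    rw [h3 z hz hz', h3 z hz hz']
  refine ⟨Equiv.swap x y, ⟨x, y, hxy 0 0, rfl⟩, hinv.toPerm, fun z => ?_⟩
  simp only [Involutive.coe_toPerm]
  by_cases hz : ∃ k, f^[k] x = z
  · obtain ⟨k, rfl⟩ := hz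
    rw [h1, ← iterate_succ_apply' f, ← iterate_succ_apply' f, h1, Equiv.swap_apply_of_ne_of_ne]
    · exact (hxy 0 (k + 1)).symm
    · intro h
      exact absurd (hya (j := 0) h) (by omega)
  by_cases hz' : ∃ k, f^[k] y = z
  · obtain ⟨k, rfl⟩ := hz'
    rw [h2, ← iterate_succ_apply' f, ← iterate_succ_apply' f, h2, Equiv.swap_apply_of_ne_of_ne]
    · intro h
      exact absurd (hxa (j := 0) h) (by omega)
    · exact hxy (k + 1) 0
  rw [h3 z hz hz']
  by_cases h4 : f z = x
  · rw [h4, Equiv.swap_apply_left]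
    exact h1 0
  by_cases h5 : f z = y
  · rw [h5, Equiv.swap_apply_right]
    exact h2 0
  rw [Equiv.swap_apply_of_ne_of_ne h4 h5]
  refine h3 _ ?_ ?_
  · rintro ⟨k, hk⟩
    cases k with
    | zero => exact h4 hk.symm
    | succ k =>
      rw [iterate_succ_apply'] at hk
      exact hz ⟨k, f.injective hk⟩
  · rintro ⟨k, hk⟩
    cases k with
    | zero => exact h5 hk.symm
    | succ k =>
      rw [iterate_succ_apply'] at hk
      exact hz' ⟨k, f.injective hk⟩

end Split

/-! ### Passing between $\approx_{\mathrm{fin}}$-equivalent maps by transpositions -/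

section SwapEquiv

variable {Ω : Type*}

open Classical in
/-- Up to conjugation `g` is the product of `f` and `k` transpositions. -/
def SwapEquiv (k : ℕ) (f g : Inj Ω) : Prop :=
  ∃ l : List (Equiv.Perm Ω), (∀ t ∈ l, t.IsSwap) ∧ l.length = k ∧
    ∃ s : Equiv.Perm Ω, ∀ x, s (g x) = l.prod (f (s x))

open Classical in
theorem exists_list_conj (s : Equiv.Perm Ω) {l : List (Equiv.Perm Ω)} (hl : ∀ t ∈ l, t.IsSwap) :
    ∃ l' : List (Equiv.Perm Ω), (∀ t ∈ l', t.IsSwap) ∧ l'.length = l.length ∧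
      l'.prod = s * l.prod * s⁻¹ := by
  refine ⟨l.map (MulAut.conj s), ?_, by simp, ?_⟩
  · intro t ht
    obtain ⟨u, hu, rfl⟩ := List.mem_map.1 ht
    obtain ⟨x, y, hxy, rfl⟩ := hl u hu
    refine ⟨s x, s y, s.injective.ne hxy, ?_⟩
    rw [MulAut.conj_apply, Equiv.swap_apply_apply]
  · rw [← map_list_prod, MulAut.conj_apply]

open Classical in
theorem exists_list_inv {l : List (Equiv.Perm Ω)} (hl : ∀ t ∈ l, t.IsSwap) :
    ∃ l' : List (Equiv.Perm Ω), (∀ t ∈ l', t.IsSwap) ∧ l'.length = l.length ∧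
      l'.prod = l.prod⁻¹ := by
  refine ⟨(l.map fun t => t⁻¹).reverse, ?_, by simp, (List.prod_inv_reverse l).symm⟩
  intro t ht
  obtain ⟨u, hu, rfl⟩ := List.mem_map.1 (List.mem_reverse.1 ht)
  obtain ⟨x, y, hxy, rfl⟩ := hl u hu
  exact ⟨x, y, hxy, Equiv.swap_inv x y⟩

theorem SwapEquiv.of_conj {f g : Inj Ω} {s : Equiv.Perm Ω} (h : ∀ x, s (g x) = f (s x)) :
    SwapEquiv 0 f g :=
  ⟨[], by simp, rfl, s, h⟩

open Classical in
theorem SwapEquiv.of_swap (f : Inj Ω) {t : Equiv.Perm Ω} (ht : t.IsSwap) :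
    SwapEquiv 1 f (f * (t.toEmbedding : Inj Ω)) :=
  ⟨[t], by simpa using ht, rfl, 1, fun x => by simp; rfl⟩

theorem SwapEquiv.symm {k : ℕ} {f g : Inj Ω} (h : SwapEquiv k f g) : SwapEquiv k g f := by
  classical
  obtain ⟨l, hl, rfl, s, hs⟩ := h
  obtain ⟨l₁, hl₁, hlen₁, h₁⟩ := exists_list_inv hl
  obtain ⟨l₂, hl₂, hlen₂, h₂⟩ := exists_list_conj s⁻¹ hl₁
  refine ⟨l₂, fun t ht => by convert hl₂ t ht, hlen₂.trans hlen₁, s⁻¹, fun x => ?_⟩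
  have h3 : s (g (s.symm x)) = l.prod (f x) := by rw [hs, Equiv.apply_symm_apply]
  rw [h₂, h₁, inv_inv]
  change s.symm (f x) = s.symm (l.prod.symm (s (g (s.symm x))))
  rw [h3, Equiv.symm_apply_apply]

theorem SwapEquiv.trans {k m : ℕ} {f g h : Inj Ω} (hfg : SwapEquiv k f g) (hgh : SwapEquiv m g h) :
    SwapEquiv (m + k) f h := by
  classical
  obtain ⟨l, hl, rfl, s, hs⟩ := hfg
  obtain ⟨l₁, hl₁, rfl, s₁, hs₁⟩ := hgh
  obtain ⟨l₂, hl₂, hlen₂, h₂⟩ := exists_list_conj s hl₁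
  refine ⟨l₂ ++ l, fun t ht => ?_, by rw [List.length_append, hlen₂], s * s₁, fun x => ?_⟩
  · rcases List.mem_append.1 ht with ht | ht
    · convert hl₂ t ht
    · convert hl t ht
  · rw [List.prod_append, h₂]
    simp [hs₁, ← hs]

theorem isFinitary_list_prod [DecidableEq Ω] {l : List (Equiv.Perm Ω)} (hl : ∀ t ∈ l, t.IsSwap) :
    IsFinitary l.prod := by
  induction l with
  | nil => simp [IsFinitary]
  | cons t l ih =>
    obtain ⟨x, y, _, rfl⟩ := hl t (by simp)
    refine ((ih fun u hu => hl u (by simp [hu])).union (Set.toFinite {x, y})).subset ?_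
    intro z hz
    by_contra hne
    simp only [Set.mem_union, Set.mem_ofPred_eq, not_or, not_not, Set.mem_insert_iff,
      Set.mem_singleton_iff] at hne
    refine hz ?_
    rw [List.prod_cons, Equiv.Perm.mul_apply, hne.1, Equiv.swap_apply_of_ne_of_ne hne.2.1 hne.2.2]

theorem SwapEquiv.mem_of_even {M : Submonoid (Inj Ω)} (hM : IsNormal (M : Set (Inj Ω)))
    (hAlt : Alt Ω ⊆ (M : Set (Inj Ω))) {k : ℕ} {f g : Inj Ω} (h : SwapEquiv k f g) (hk : Even k)
    (hf : f ∈ M) : g ∈ M := by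
  classical
  obtain ⟨l, hl, rfl, s, hs⟩ := h
  have h1 : (l.prod.toEmbedding : Inj Ω) ∈ M :=
    hAlt ⟨l.prod, isFinitary_list_prod fun t ht => by convert hl t ht,
      ⟨l, fun t ht => by convert hl t ht, hk, rfl⟩, rfl⟩
  have h2 := hM _ (M.mul_mem hf h1) s
  have h3 : g = (s.toEmbedding : Inj Ω) * (f * (l.prod.toEmbedding : Inj Ω)) *
      (s.symm.toEmbedding : Inj Ω) := by
    ext x
    change g x = s.symm (l.prod (f (s x)))
    rw [← hs, Equiv.symm_apply_apply]
  rw [h3]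
  exact h2

theorem FinEquiv.symm {f g : Inj Ω} (h : FinEquiv f g) : FinEquiv g f :=
  ⟨h.1.symm, h.2.1.symm, by simpa only [ne_comm] using h.2.2.1,
    fun n hn => (h.2.2.2 n hn.symm).symm⟩

theorem FinEquiv.trans_of_ne {f f' g : Inj Ω} (h : FinEquiv f g) {n : ℕ+}
    (h1 : numOpen f' = numOpen f) (h2 : numFwd f' = numFwd f)
    (h3 : ∀ m ≠ n, numCycles f' m = numCycles f m) (h4 : numCycles f' n < ⊤)
    (h5 : numCycles g n < ⊤) : FinEquiv f' g := by
  refine ⟨h1.trans h.1, h2.trans h.2.1, ?_, fun m hm => ?_⟩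
  · refine (h.2.2.1.union (Set.finite_singleton n)).subset fun m hm => ?_
    by_cases hmn : m = n
    · exact Or.inr hmn
    · refine Or.inl ?_
      rwa [Set.mem_ofPred_eq, h3 m hmn] at hm
  · by_cases hmn : m = n
    · subst hmn; exact ⟨h4, h5⟩
    · rw [h3 m hmn] at hm ⊢
      exact h.2.2.2 m hm

/-- The difference between the numbers of cycles of cardinality `n`. -/
noncomputable def cycleDiff (f g : Inj Ω) (n : ℕ+) : ℤ :=
  ((numCycles f n).toNat : ℤ) - ((numCycles g n).toNat : ℤ)

theorem cycleDiff_comm (f g : Inj Ω) (n : ℕ+) : cycleDiff g f n = -cycleDiff f g n := by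
  simp [cycleDiff]

theorem FinEquiv.support_subset {f g : Inj Ω} (h : FinEquiv f g) :
    Function.support (cycleDiff f g) ⊆ h.2.2.1.toFinset := by
  intro n hn
  simp only [Set.Finite.coe_toFinset, Set.mem_ofPred_eq]
  rintro h'
  exact hn (by simp [cycleDiff, h'])

/-- As long as some count differs, the map with fewer `n`-cycles gets one more, cut out of an
infinite cycle, and the total difference drops by one. At total difference 0 the maps are conjugate.
-/
theorem swapEquiv_of_sum_natAbs [Countable Ω] {s : Finset ℕ+} (N : ℕ) {f g : Inj Ω}
    (h : FinEquiv f g) (hinf : 1 ≤ numOpen f + numFwd f)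
    (hs : ∀ n, numCycles f n ≠ numCycles g n → n ∈ s)
    (hN : ∑ n ∈ s, (cycleDiff f g n).natAbs = N) : SwapEquiv N f g := by
  classical
  induction N generalizing f g with
  | zero =>
    have hc : ∀ n, numCycles f n = numCycles g n := by
      intro n
      by_contra hn
      have h1 := Finset.sum_eq_zero_iff.1 hN n (hs n hn)
      rw [Int.natAbs_eq_zero, cycleDiff, sub_eq_zero, Nat.cast_inj] at h1
      obtain ⟨h2, h3⟩ := h.2.2.2 n hn
      exact hn (by rw [← ENat.natCast_toNat h2.ne, h1, ENat.natCast_toNat h3.ne])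
    obtain ⟨t, ht⟩ := exists_perm_of_counts h.1.symm h.2.1.symm fun n => (hc n).symm
    exact .of_conj ht
  | succ N ih =>
    -- The case in which `f` lacks an `n`-cycle. The opposite case follows by exchanging `f` and
    -- `g`, since `SwapEquiv` is symmetric.
    have key : ∀ f g : Inj Ω, FinEquiv f g → 1 ≤ numOpen f + numFwd f →
        (∀ n, numCycles f n ≠ numCycles g n → n ∈ s) →
        ∑ n ∈ s, (cycleDiff f g n).natAbs = N + 1 → (∃ n, cycleDiff f g n < 0) →
        SwapEquiv (N + 1) f g := by
      rintro f g h hinf hs hN ⟨n, hn⟩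
      have hne : numCycles f n ≠ numCycles g n := fun h' => by simp [cycleDiff, h'] at hn
      obtain ⟨hf, hg⟩ := h.2.2.2 n hne
      obtain ⟨S, hS, hSinf⟩ := exists_infinite_cycle hinf
      obtain ⟨t, ht, C, hC⟩ := exists_isSplitting hS hSinf n.pos
      have h3 : ∀ m ≠ n, numCycles (f * (t.toEmbedding : Inj Ω)) m = numCycles f m :=
        fun m hm => hC.numCycles_of_ne fun h' => hm (PNat.coe_inj.1 h')
      have h4 : numCycles (f * (t.toEmbedding : Inj Ω)) n < ⊤ := by
        rw [hC.numCycles_self]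
        exact WithTop.add_lt_top.2 ⟨hf, ENat.one_lt_top⟩
      have h5 : cycleDiff (f * (t.toEmbedding : Inj Ω)) g n = cycleDiff f g n + 1 := by
        rw [cycleDiff, hC.numCycles_self, ENat.toNat_add hf.ne ENat.one_ne_top, cycleDiff]
        push_cast [ENat.toNat_one]
        ring
      have h6 := ih (f := f * (t.toEmbedding : Inj Ω)) (g := g)
        (h.trans_of_ne hC.numOpen_eq hC.numFwd_eq h3 h4 hg)
        (by rwa [hC.numOpen_eq, hC.numFwd_eq])
        (fun m hm => by
          by_cases hmn : m = n
          · exact hmn ▸ hs n hne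
          · rw [h3 m hmn] at hm
            exact hs m hm)
        (by
          rw [← Finset.add_sum_erase s _ (hs n hne)] at hN ⊢
          rw [h5, Finset.sum_congr rfl (g := fun m => (cycleDiff f g m).natAbs)]
          · omega
          · intro m hm
            rw [cycleDiff, cycleDiff, h3 m (Finset.ne_of_mem_erase hm)])
      exact (SwapEquiv.of_swap f ht).trans h6
    obtain ⟨n, hn, hn'⟩ : ∃ n ∈ s, (cycleDiff f g n).natAbs ≠ 0 := by
      by_contra hne
      push Not at hne
      rw [Finset.sum_eq_zero hne] at hN
      omega
    rcases lt_or_gt_of_ne (Int.natAbs_ne_zero.1 hn') with h1 | h1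
    · exact key f g h hinf hs hN ⟨n, h1⟩
    · refine (key g f h.symm (by rwa [← h.1, ← h.2.1]) (fun m hm => hs m hm.symm) ?_ ⟨n, ?_⟩).symm
      · rw [← hN]
        exact Finset.sum_congr rfl fun m _ => by rw [cycleDiff_comm f g, Int.natAbs_neg]
      · rw [cycleDiff_comm f g]; omega

theorem even_sum_natAbs_iff {ι : Type*} (s : Finset ι) (d : ι → ℤ) :
    Even (∑ n ∈ s, (d n).natAbs) ↔ Even (∑ n ∈ s, d n) := by
  classical
  induction s using Finset.induction_on with
  | empty => simp
  | insert a s ha ih => rw [Finset.sum_insert ha, Finset.sum_insert ha, Nat.even_add, Int.even_add,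
      ih, Int.natAbs_even]

theorem FinEquiv.exists_swapEquiv [Countable Ω] {f g : Inj Ω} (h : FinEquiv f g)
    (hinf : 1 ≤ numOpen f + numFwd f) :
    ∃ N, SwapEquiv N f g ∧ (Even N ↔ Even (∑ᶠ n, cycleDiff f g n)) := by
  refine ⟨_, swapEquiv_of_sum_natAbs (s := h.2.2.1.toFinset) _ h hinf (fun n hn => by simpa using hn)
    rfl, ?_⟩
  rw [even_sum_natAbs_iff, finsum_eq_sum_of_support_subset _ h.support_subset]

theorem EvenEquiv.mem [Countable Ω] {M : Submonoid (Inj Ω)} (hM : IsNormal (M : Set (Inj Ω)))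
    (hAlt : Alt Ω ⊆ (M : Set (Inj Ω))) {f g : Inj Ω} (h : EvenEquiv f g)
    (hinf : 1 ≤ numOpen f + numFwd f) (hf : f ∈ M) : g ∈ M := by
  obtain ⟨N, h1, h2⟩ := h.1.exists_swapEquiv hinf
  exact h1.mem_of_even hM hAlt (h2.2 h.2) hf

/-- If the number of transpositions leading to `g` is odd, the extra transposition from `hf1` makes
it even. -/
theorem FinEquiv.mem_of_swapEquiv_self [Countable Ω] {M : Submonoid (Inj Ω)}
    (hM : IsNormal (M : Set (Inj Ω))) (hAlt : Alt Ω ⊆ (M : Set (Inj Ω))) {f g : Inj Ω}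
    (h : FinEquiv f g) (hinf : 1 ≤ numOpen f + numFwd f) (hf1 : SwapEquiv 1 f f) (hf : f ∈ M) :
    g ∈ M := by
  obtain ⟨N, h1, -⟩ := h.exists_swapEquiv hinf
  rcases Nat.even_or_odd N with hN | hN
  · exact h1.mem_of_even hM hAlt hN hf
  · exact (hf1.trans h1).mem_of_even hM hAlt hN.add_one hf

theorem swapEquiv_self_of_two_le {f : Inj Ω} (h : 2 ≤ numOpen f + numFwd f) : SwapEquiv 1 f f := by
  classical
  obtain ⟨S, T, hS, hS', hT, hT', hST⟩ := exists_infinite_cycles h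
  obtain ⟨t, ht, s, hs⟩ := exists_swap_conj hS hS' hT hT' hST
  exact (SwapEquiv.of_swap f ht).trans (SwapEquiv.of_conj (s := s) hs)

/-- Cutting one more `n`-cycle out of an infinite cycle leaves their number infinite, so no count
changes. -/
theorem swapEquiv_self_of_numCycles_eq_top [Countable Ω] {f : Inj Ω}
    (h : 1 ≤ numOpen f + numFwd f) {n : ℕ+} (hn : numCycles f n = ⊤) : SwapEquiv 1 f f := by
  classical
  obtain ⟨S, hS, hS'⟩ := exists_infinite_cycle h
  obtain ⟨t, ht, C, hC⟩ := exists_isSplitting hS hS' n.pos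
  obtain ⟨s, hs⟩ := exists_perm_of_counts hC.numOpen_eq.symm hC.numFwd_eq.symm fun m => by
    by_cases hm : m = n
    · rw [hm, hC.numCycles_self, hn, top_add]
    · exact (hC.numCycles_of_ne fun h' => hm (PNat.coe_inj.1 h')).symm
  exact (SwapEquiv.of_swap f ht).trans (SwapEquiv.of_conj hs)

end SwapEquiv

/-! ### Coimages of products and permutations -/

section Conj

variable {Ω : Type*}

theorem encard_coimage_mul (f g : Inj Ω) :
    (coimage (f * g)).encard = (coimage f).encard + (coimage g).encard := by
  have h : coimage (f * g) = g '' coimage f ∪ coimage g := by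
    ext z
    constructor
    · intro hz
      by_cases hzg : z ∈ Set.range g
      · obtain ⟨w, rfl⟩ := hzg
        refine Or.inl ⟨w, ?_, rfl⟩
        rintro ⟨v, rfl⟩
        exact hz ⟨v, rfl⟩
      · exact Or.inr hzg
    · rintro (⟨w, hw, rfl⟩ | hz)
      · rintro ⟨v, hv⟩
        exact hw ⟨v, g.injective hv⟩
      · rintro ⟨v, hv⟩
        exact hz ⟨f v, hv⟩
  rw [h, Set.encard_union_eq, g.injective.encard_image]
  rw [Set.disjoint_left]
  rintro _ ⟨w, _, rfl⟩ h'
  exact h' ⟨w, rfl⟩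

theorem coimage_perm (a : Equiv.Perm Ω) : coimage (a.toEmbedding : Inj Ω) = ∅ := by
  rw [coimage, Set.compl_empty_iff]
  exact a.surjective.range_eq

theorem encard_coimage_conj (f : Inj Ω) (a : Equiv.Perm Ω) :
    (coimage ((a.toEmbedding : Inj Ω) * f * (a.symm.toEmbedding : Inj Ω))).encard =
      (coimage f).encard := by
  simp [encard_coimage_mul, coimage_perm]

theorem mem_symInj_iff {f : Inj Ω} : f ∈ SymInj Ω ↔ coimage f = ∅ := by
  constructor
  · rintro ⟨a, rfl⟩
    exact coimage_perm a
  · intro h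
    rw [coimage, Set.compl_empty_iff, Set.range_eq_univ] at h
    have hb : Bijective f := ⟨f.injective, h⟩
    exact ⟨Equiv.ofBijective f hb, by ext x; rfl⟩

end Conj

/-! ### Invariance of the cycle counts under conjugation -/

section Conj

variable {Ω : Type*}

theorem isFullyInvariant_conj (f : Inj Ω) (a : Equiv.Perm Ω) (S : Set Ω) :
    IsFullyInvariant ((a.toEmbedding : Inj Ω) * f * (a.symm.toEmbedding : Inj Ω)) (a ⁻¹' S) ↔
      IsFullyInvariant f S := by
  refine Iff.trans (forall_congr' fun x => ?_) a.forall_congr_right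
  change (a (a.symm (f (a x))) ∈ S ↔ a x ∈ S) ↔ _
  rw [Equiv.apply_symm_apply]

theorem isCycle_conj (f : Inj Ω) (a : Equiv.Perm Ω) (S : Set Ω) :
    IsCycle ((a.toEmbedding : Inj Ω) * f * (a.symm.toEmbedding : Inj Ω)) (a ⁻¹' S) ↔
      IsCycle f S := by
  have hne : ∀ T : Set Ω, (a ⁻¹' T).Nonempty ↔ T.Nonempty := fun T =>
    ⟨fun ⟨x, hx⟩ => ⟨a x, hx⟩, fun h => h.preimage a.surjective⟩
  have hss : ∀ T : Set Ω, a ⁻¹' T ⊂ a ⁻¹' S ↔ T ⊂ S := fun T => by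
    simp only [ssubset_iff_subset_not_subset, a.surjective.preimage_subset_preimage_iff]
  refine and_congr (hne S) (and_congr (isFullyInvariant_conj f a S) ?_)
  refine Iff.trans (Set.preimage_surjective.2 a.injective).forall (forall_congr' fun T => ?_)
  rw [hss, hne, isFullyInvariant_conj]

theorem encard_setOf_preimage (a : Equiv.Perm Ω) {p p' : Set Ω → Prop}
    (h : ∀ S, p' (a ⁻¹' S) ↔ p S) : {S | p' S}.encard = {S | p S}.encard := by
  have : {S | p' S} = (fun S => a ⁻¹' S) '' {S | p S} := by
    ext S
    constructor
    · intro hS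
      obtain ⟨T, rfl⟩ := Set.preimage_surjective.2 a.injective S
      exact ⟨T, (h T).1 hS, rfl⟩
    · rintro ⟨T, hT, rfl⟩
      exact (h T).2 hT
  rw [this, a.surjective.preimage_injective.encard_image]

theorem encard_preimage_perm (a : Equiv.Perm Ω) (S : Set Ω) : (a ⁻¹' S).encard = S.encard := by
  rw [← a.injective.encard_image, Set.image_preimage_eq S a.surjective]

theorem isForwardCycle_conj (f : Inj Ω) (a : Equiv.Perm Ω) (S : Set Ω) :
    IsForwardCycle ((a.toEmbedding : Inj Ω) * f * (a.symm.toEmbedding : Inj Ω)) (a ⁻¹' S) ↔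
      IsForwardCycle f S := by
  have hr : a ⁻¹' S \ Set.range ((a.toEmbedding : Inj Ω) * f * (a.symm.toEmbedding : Inj Ω)) =
      a ⁻¹' (S \ Set.range f) := by
    ext x
    refine and_congr_right fun _ => not_congr ⟨?_, ?_⟩
    · rintro ⟨y, rfl⟩
      exact ⟨a y, (Equiv.apply_symm_apply a _).symm⟩
    · rintro ⟨y, hy⟩
      refine ⟨a.symm y, ?_⟩
      change a.symm (f (a (a.symm y))) = x
      rw [Equiv.apply_symm_apply, hy, Equiv.symm_apply_apply]
  refine and_congr (isCycle_conj f a S) (and_congr ?_ ?_)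
  · rw [← Set.encard_eq_top_iff, encard_preimage_perm, Set.encard_eq_top_iff]
  · rw [hr]
    exact ⟨fun ⟨x, hx⟩ => ⟨a x, hx⟩, fun h => h.preimage a.surjective⟩

theorem evenEquiv_conj (f : Inj Ω) (a : Equiv.Perm Ω) :
    EvenEquiv f ((a.toEmbedding : Inj Ω) * f * (a.symm.toEmbedding : Inj Ω)) := by
  have h1 : numFwd f = numFwd ((a.toEmbedding : Inj Ω) * f * (a.symm.toEmbedding : Inj Ω)) :=
    (encard_setOf_preimage a (isForwardCycle_conj f a)).symm
  have h2 : numOpen f = numOpen ((a.toEmbedding : Inj Ω) * f * (a.symm.toEmbedding : Inj Ω)) := by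
    refine (encard_setOf_preimage a fun S => ?_).symm
    refine and_congr (isCycle_conj f a S) (and_congr ?_ (not_congr (isForwardCycle_conj f a S)))
    rw [← Set.encard_eq_top_iff, encard_preimage_perm, Set.encard_eq_top_iff]
  have h3 : ∀ n, numCycles f n =
      numCycles ((a.toEmbedding : Inj Ω) * f * (a.symm.toEmbedding : Inj Ω)) n := by
    intro n
    refine (encard_setOf_preimage a fun S => ?_).symm
    rw [encard_preimage_perm, isCycle_conj]
  refine ⟨⟨h2, h1, ?_, fun n hn => absurd (h3 n) hn⟩, ?_⟩
  · simp [h3]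
  · simp [h3]

theorem isNormal_alt : IsNormal (Alt Ω) := by
  classical
  rintro _ ⟨b, _, ⟨l, hl, hlen, rfl⟩, rfl⟩ a
  obtain ⟨l', hl', hlen', h'⟩ := exists_list_conj a⁻¹ hl
  refine ⟨l'.prod, isFinitary_list_prod hl', ⟨l', hl', hlen' ▸ hlen, rfl⟩, ?_⟩
  rw [h', inv_inv]
  rfl

end Conj

/-! ### Non-generators of a monoid of natural numbers are decomposable -/

section Gn

theorem Gn_subset_self (N : AddSubmonoid ℕ) : Gn N ⊆ N :=
  Gn_subset N N (AddSubmonoid.closure_eq N)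

theorem zero_notMem_Gn (N : AddSubmonoid ℕ) : 0 ∉ Gn N := by
  intro h
  have h1 : AddSubmonoid.closure ((N : Set ℕ) \ {0}) = N := by
    refine le_antisymm (AddSubmonoid.closure_le.2 Set.sdiff_subset) fun n hn => ?_
    by_cases h0 : n = 0
    · rw [h0]; exact zero_mem _
    · exact AddSubmonoid.subset_closure ⟨hn, h0⟩
  exact (Gn_subset N _ h1 h).2 rfl

theorem exists_add_of_notMem_Gn {N : AddSubmonoid ℕ} {n : ℕ} (hn : n ∈ N) (h0 : n ≠ 0)
    (hG : n ∉ Gn N) : ∃ a ∈ N, ∃ b ∈ N, a ≠ 0 ∧ b ≠ 0 ∧ n = a + b := by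
  simp only [Gn, Set.mem_sInter, Set.mem_ofPred_eq, not_forall] at hG
  obtain ⟨G, rfl, hnG⟩ := hG
  have key : ∀ m ∈ AddSubmonoid.closure G, m ∈ G ∨ m = 0 ∨ ∃ a ∈ AddSubmonoid.closure G,
      ∃ b ∈ AddSubmonoid.closure G, a ≠ 0 ∧ b ≠ 0 ∧ m = a + b := by
    intro m hm
    induction hm using AddSubmonoid.closure_induction with
    | mem x hx => exact Or.inl hx
    | zero => exact Or.inr (Or.inl rfl)
    | add x y hx hy ihx ihy =>
      by_cases hx0 : x = 0
      · rwa [hx0, zero_add]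
      by_cases hy0 : y = 0
      · rwa [hy0, add_zero]
      exact Or.inr (Or.inr ⟨x, hx, y, hy, hx0, hy0, rfl⟩)
  exact ((key n hn).resolve_left hnG).resolve_left h0

end Gn

/-! ### The two directions of the characterization -/

section Normal

variable {Ω : Type*}

theorem mem_injFin_iff {f : Inj Ω} : f ∈ InjFin Ω ↔ ∃ n : ℕ, n ≠ 0 ∧ (coimage f).encard = n := by
  constructor
  · rintro ⟨h1, h2⟩
    refine ⟨(coimage f).ncard, ?_, h2.cast_ncard_eq.symm⟩
    rw [Ne, Set.ncard_eq_zero h2]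
    exact h1.ne_empty
  · rintro ⟨n, hn, h⟩
    refine ⟨?_, Set.finite_of_encard_eq_coe h⟩
    rw [Set.nonempty_iff_ne_empty]
    intro h'
    rw [h', Set.encard_empty] at h
    exact hn (by exact_mod_cast h.symm)

theorem mem_alt_or_injFin_or_injInf {M : Submonoid (Inj Ω)}
    (hM : (M : Set (Inj Ω)) ∩ SymInj Ω = Alt Ω) {f : Inj Ω} (hf : f ∈ M) :
    f ∈ Alt Ω ∨ f ∈ (M : Set (Inj Ω)) ∩ InjFin Ω ∨ f ∈ InjInf Ω := by
  by_cases h1 : (coimage f).Infinite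
  · exact Or.inr (Or.inr h1)
  rcases (coimage f).eq_empty_or_nonempty with h2 | h2
  · exact Or.inl (hM ▸ ⟨hf, mem_symInj_iff.2 h2⟩)
  · exact Or.inr (Or.inl ⟨hf, h2, Set.not_infinite.1 h1⟩)

theorem mem_of_encard_coimage_eq_add [Countable Ω] {M : Submonoid (Inj Ω)}
    (hM : IsNormal (M : Set (Inj Ω))) {f g h : Inj Ω} (hf : f ∈ M) (hg : g ∈ M)
    (hf' : (coimage f).Nonempty) (hg' : (coimage g).Nonempty)
    (hd : (coimage f).encard + (coimage g).encard = (coimage h).encard) : h ∈ M := by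
  obtain ⟨a, b, rfl⟩ := exists_mul_conj_eq hf' hg' hd
  exact M.mul_mem (hM f hf a) (hM g hg b)

/-- The additive monoid of the finite coimage sizes of the members of `M`. -/
def coimageSizeSubmonoid (M : Submonoid (Inj Ω)) : AddSubmonoid ℕ where
  carrier := coimageSizes (M : Set (Inj Ω))
  zero_mem' := ⟨1, M.one_mem, by
    have : coimage (1 : Inj Ω) = ∅ := coimage_perm (Equiv.refl Ω)
    rw [this, Set.encard_empty, Nat.cast_zero]⟩
  add_mem' := by
    rintro m n ⟨f, hf, hm⟩ ⟨g, hg, hn⟩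
    exact ⟨f * g, M.mul_mem hf hg, by rw [encard_coimage_mul, hm, hn, Nat.cast_add]⟩

theorem mem_coimageSizeSubmonoid {M : Submonoid (Inj Ω)} {n : ℕ} :
    n ∈ coimageSizeSubmonoid M ↔ ∃ f ∈ M, (coimage f).encard = n := Iff.rfl

theorem one_le_of_mem_injFin {f : Inj Ω} (hf : f ∈ InjFin Ω) : 1 ≤ numOpen f + numFwd f := by
  rw [numFwd_eq]
  exact (Set.one_le_encard_iff_nonempty.2 hf.1).trans le_add_self

theorem FinEquiv.encard_coimage {f g : Inj Ω} (h : FinEquiv f g) :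
    (coimage f).encard = (coimage g).encard := by
  rw [← numFwd_eq, ← numFwd_eq, h.2.1]

theorem FinEquiv.numCycles_eq_top {f g : Inj Ω} (h : FinEquiv f g) {n : ℕ+}
    (hn : numCycles f n = ⊤) : numCycles g n = ⊤ := by
  by_contra hne
  exact (h.2.2.2 n fun h' => hne (h' ▸ hn)).1.ne hn

theorem isNormal_of_structure {M : Submonoid (Inj Ω)}
    (hM : (M : Set (Inj Ω)) ∩ SymInj Ω = Alt Ω)
    (h : (M : Set (Inj Ω)) = Alt Ω ∪ ((M : Set (Inj Ω)) ∩ InjFin Ω) ∨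
        (M : Set (Inj Ω)) = Alt Ω ∪ ((M : Set (Inj Ω)) ∩ InjFin Ω) ∪ InjInf Ω)
    {N : AddSubmonoid ℕ} {B : Set (Inj Ω)} (hB : B ⊆ InjFin Ω)
    (hfin : (M : Set (Inj Ω)) ∩ InjFin Ω =
          B ∪ {f | ∃ n ∈ (N : Set ℕ) \ (Gn N ∪ {0}), (coimage f).encard = n})
    (h2 : FinClosed {f ∈ B | 2 ≤ numOpen f + numFwd f})
    (h3 : FinClosed {f ∈ B | ∃ n : ℕ+, numCycles f n = ⊤})
    (h4 : EvenClosed {f ∈ B | numOpen f + numFwd f = 1 ∧ ∀ n : ℕ+, numCycles f n < ⊤}) :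
    IsNormal (M : Set (Inj Ω)) := by
  intro f hf a
  rcases mem_alt_or_injFin_or_injInf hM hf with h' | h' | h'
  · exact (hM.superset (isNormal_alt f h' a)).1
  · refine (hfin.superset ?_).1
    rcases hfin.subset h' with h' | ⟨n, hn, h'⟩
    · refine Or.inl ?_
      have he := evenEquiv_conj f a
      -- Every `f ∈ B` is in one of the three closed sets: if the first two fail, there is at most
      -- one infinite cycle, and at least one since the coimage is nonempty.
      by_cases hc : ∃ n : ℕ+, numCycles f n = ⊤
      · exact ((h3 _ _ he.1).1 ⟨h', hc⟩).1
      by_cases h5 : 2 ≤ numOpen f + numFwd f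
      · exact ((h2 _ _ he.1).1 ⟨h', h5⟩).1
      · refine ((h4 _ _ he).1 ⟨h', ?_, fun n => ?_⟩).1
        · refine le_antisymm ?_ (one_le_of_mem_injFin (hB h'))
          rw [← ENat.lt_add_one_iff ENat.one_ne_top]
          simpa [one_add_one_eq_two] using h5
        · exact lt_top_iff_ne_top.2 fun h6 => hc ⟨n, h6⟩
    · exact Or.inr ⟨n, hn, (encard_coimage_conj f a).trans h'⟩
  · have h5 : ∀ g, g ∈ InjInf Ω ↔ (coimage g).encard = ⊤ := fun g => Set.encard_eq_top_iff.symm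
    rcases h with h | h
    · rcases h.subset hf with h6 | h6
      · exact absurd (mem_symInj_iff.1 (hM.superset h6).2) (Set.Infinite.nonempty h').ne_empty
      · exact absurd h6.2.2 h'
    · refine h.superset (Or.inr ?_)
      rw [h5, encard_coimage_conj]
      exact (h5 f).1 h'

theorem structure_of_isNormal [Countable Ω] {M : Submonoid (Inj Ω)}
    (hM : (M : Set (Inj Ω)) ∩ SymInj Ω = Alt Ω) (h : IsNormal (M : Set (Inj Ω))) :
    ((M : Set (Inj Ω)) = Alt Ω ∪ ((M : Set (Inj Ω)) ∩ InjFin Ω) ∨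
        (M : Set (Inj Ω)) = Alt Ω ∪ ((M : Set (Inj Ω)) ∩ InjFin Ω) ∪ InjInf Ω) ∧
      ∃ (N : AddSubmonoid ℕ) (B : Set (Inj Ω)),
        B ⊆ InjFin Ω ∧
        (M : Set (Inj Ω)) ∩ InjFin Ω =
          B ∪ {f | ∃ n ∈ (N : Set ℕ) \ (Gn N ∪ {0}), (coimage f).encard = n} ∧
        coimageSizes B = Gn N ∧
        FinClosed {f ∈ B | 2 ≤ numOpen f + numFwd f} ∧
        FinClosed {f ∈ B | ∃ n : ℕ+, numCycles f n = ⊤} ∧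
        EvenClosed {f ∈ B | numOpen f + numFwd f = 1 ∧ ∀ n : ℕ+, numCycles f n < ⊤} := by
  have hAlt : Alt Ω ⊆ (M : Set (Inj Ω)) := fun f hf => (hM.superset hf).1
  -- A common frame for the three closure conditions. The relation `r` preserves coimage sizes,
  -- because they count the forward cycles, so only membership in `M` depends on the case.
  have hclosed : ∀ (p : Inj Ω → Prop) (r : Inj Ω → Inj Ω → Prop), (∀ f g, r f g → FinEquiv f g) →
      (∀ f g, r f g → r g f) → (∀ f g, r f g → p f → p g) →
      (∀ f g, r f g → f ∈ M → 1 ≤ numOpen f + numFwd f → p f → g ∈ M) → ∀ f g, r f g →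
      (f ∈ {f ∈ {f ∈ (M : Set (Inj Ω)) ∩ InjFin Ω |
        ∃ n ∈ Gn (coimageSizeSubmonoid M), (coimage f).encard = n} | p f} ↔
      g ∈ {f ∈ {f ∈ (M : Set (Inj Ω)) ∩ InjFin Ω |
        ∃ n ∈ Gn (coimageSizeSubmonoid M), (coimage f).encard = n} | p f}) := by
    intro p r hr hr' hp hmem
    have key : ∀ f g, r f g → (f ∈ {f ∈ {f ∈ (M : Set (Inj Ω)) ∩ InjFin Ω |
        ∃ n ∈ Gn (coimageSizeSubmonoid M), (coimage f).encard = n} | p f} →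
        g ∈ {f ∈ {f ∈ (M : Set (Inj Ω)) ∩ InjFin Ω |
        ∃ n ∈ Gn (coimageSizeSubmonoid M), (coimage f).encard = n} | p f}) := by
      rintro f g hfg ⟨⟨⟨hf, hf'⟩, n, hn, hfn⟩, hpf⟩
      have hg := (hr f g hfg).encard_coimage
      refine ⟨⟨⟨hmem f g hfg hf (one_le_of_mem_injFin hf') hpf, ?_⟩, n, hn, hg ▸ hfn⟩, hp f g hfg hpf⟩
      rwa [mem_injFin_iff, ← hg, ← mem_injFin_iff]
    exact fun f g hfg => ⟨key f g hfg, key g f (hr' f g hfg)⟩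
  refine ⟨?_, coimageSizeSubmonoid M, {f ∈ (M : Set (Inj Ω)) ∩ InjFin Ω |
    ∃ n ∈ Gn (coimageSizeSubmonoid M), (coimage f).encard = n}, fun f hf => hf.1.2, ?_, ?_, ?_, ?_,
    ?_⟩
  · by_cases hinf : ∃ f ∈ M, f ∈ InjInf Ω
    · refine Or.inr (Set.Subset.antisymm (fun f hf => ?_) ?_)
      · rw [Set.union_assoc]
        exact mem_alt_or_injFin_or_injInf hM hf
      · rintro g ((hg | hg) | hg)
        · exact hAlt hg
        · exact hg.1
        · obtain ⟨f, hf, hf'⟩ := hinf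
          refine mem_of_encard_coimage_eq_add h hf hf hf'.nonempty hf'.nonempty ?_
          rw [Set.Infinite.encard_eq hf', Set.Infinite.encard_eq hg, top_add]
    · refine Or.inl (Set.Subset.antisymm (fun f hf => ?_) ?_)
      · rcases mem_alt_or_injFin_or_injInf hM hf with h1 | h1 | h1
        exacts [Or.inl h1, Or.inr h1, absurd ⟨f, hf, h1⟩ hinf]
      · rintro g (hg | hg)
        exacts [hAlt hg, hg.1]
  · ext f
    constructor
    · intro hf
      obtain ⟨n, hn, hfn⟩ := mem_injFin_iff.1 hf.2
      by_cases hG : n ∈ Gn (coimageSizeSubmonoid M)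
      · exact Or.inl ⟨hf, n, hG, hfn⟩
      · refine Or.inr ⟨n, ⟨mem_coimageSizeSubmonoid.2 ⟨f, hf.1, hfn⟩, ?_⟩, hfn⟩
        rintro (h1 | h1)
        exacts [hG h1, hn h1]
    · rintro (hf | ⟨n, ⟨hn, hn'⟩, hfn⟩)
      · exact hf.1
      · simp only [Set.mem_union, Set.mem_singleton_iff, not_or] at hn'
        refine ⟨?_, mem_injFin_iff.2 ⟨n, hn'.2, hfn⟩⟩
        -- A nonzero size that is not a generator is a sum of two nonzero sizes in `N`, so the
        -- factorization puts every map of this size into `M`.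
        obtain ⟨a, ha', b, hb', ha, hb, rfl⟩ := exists_add_of_notMem_Gn hn hn'.2 hn'.1
        obtain ⟨f₁, hf₁, h₁⟩ := mem_coimageSizeSubmonoid.1 ha'
        obtain ⟨f₂, hf₂, h₂⟩ := mem_coimageSizeSubmonoid.1 hb'
        exact mem_of_encard_coimage_eq_add h hf₁ hf₂ (mem_injFin_iff.2 ⟨a, ha, h₁⟩).1
          (mem_injFin_iff.2 ⟨b, hb, h₂⟩).1 (by rw [h₁, h₂, hfn, Nat.cast_add])
  · ext n
    constructor
    · rintro ⟨f, ⟨_, m, hm, hfm⟩, hfn⟩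
      rw [hfm, Nat.cast_inj] at hfn
      exact hfn ▸ hm
    · intro hn
      obtain ⟨f, hf, hfn⟩ := mem_coimageSizeSubmonoid.1 (Gn_subset_self _ hn)
      refine ⟨f, ⟨⟨hf, mem_injFin_iff.2 ⟨n, ?_, hfn⟩⟩, n, hn, hfn⟩, hfn⟩
      rintro rfl
      exact zero_notMem_Gn _ hn
  · refine hclosed (fun f => 2 ≤ numOpen f + numFwd f) FinEquiv (fun _ _ => id)
      (fun _ _ => FinEquiv.symm) (fun f g hfg hp => ?_) fun f g hfg hf h1 hp => ?_
    · rwa [← hfg.1, ← hfg.2.1]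
    · exact hfg.mem_of_swapEquiv_self h hAlt h1 (swapEquiv_self_of_two_le hp) hf
  · refine hclosed (fun f => ∃ n : ℕ+, numCycles f n = ⊤) FinEquiv (fun _ _ => id)
      (fun _ _ => FinEquiv.symm) (fun f g hfg hp => ?_) fun f g hfg hf h1 hp => ?_
    · exact hp.imp fun n => hfg.numCycles_eq_top
    · obtain ⟨n, hn⟩ := hp
      exact hfg.mem_of_swapEquiv_self h hAlt h1 (swapEquiv_self_of_numCycles_eq_top h1 hn) hf
  · refine hclosed (fun f => numOpen f + numFwd f = 1 ∧ ∀ n : ℕ+, numCycles f n < ⊤) EvenEquiv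
      (fun _ _ => And.left) (fun f g hfg => ⟨hfg.1.symm, ?_⟩) (fun f g hfg hp => ⟨?_, fun n => ?_⟩)
      fun f g hfg hf h1 _ => hfg.mem h hAlt h1 hf
    · have h1 := hfg.2
      change Even (∑ᶠ n, cycleDiff g f n)
      simp only [cycleDiff_comm f g]
      rw [finsum_neg_distrib, even_neg]
      exact h1
    · rw [← hfg.1.1, ← hfg.1.2.1]
      exact hp.1
    · refine lt_top_iff_ne_top.2 fun hn => (hp.2 n).ne ?_
      exact hfg.1.symm.numCycles_eq_top hn

end Normal

end InjMonoid

theorem mainTheorem2 {Ω : Type*} [Countable Ω] [Infinite Ω] (M : Submonoid (Inj Ω))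
    (hM : (M : Set (Inj Ω)) ∩ SymInj Ω = Alt Ω) :
    IsNormal (M : Set (Inj Ω)) ↔
      ((M : Set (Inj Ω)) = Alt Ω ∪ ((M : Set (Inj Ω)) ∩ InjFin Ω) ∨
        (M : Set (Inj Ω)) = Alt Ω ∪ ((M : Set (Inj Ω)) ∩ InjFin Ω) ∪ InjInf Ω) ∧
      ∃ (N : AddSubmonoid ℕ) (B : Set (Inj Ω)),
        B ⊆ InjFin Ω ∧
        (M : Set (Inj Ω)) ∩ InjFin Ω =
          B ∪ {f | ∃ n ∈ (N : Set ℕ) \ (Gn N ∪ {0}), (coimage f).encard = n} ∧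
        coimageSizes B = Gn N ∧
        FinClosed {f ∈ B | 2 ≤ numOpen f + numFwd f} ∧
        FinClosed {f ∈ B | ∃ n : ℕ+, numCycles f n = ⊤} ∧
        EvenClosed {f ∈ B | numOpen f + numFwd f = 1 ∧ ∀ n : ℕ+, numCycles f n < ⊤} :=
  ⟨structure_of_isNormal hM, fun ⟨h, _, _, hB, hfin, _, h2, h3, h4⟩ =>
    isNormal_of_structure hM h hB hfin h2 h3 h4⟩
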